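/- Let $k$ be an algebraically closed field. A \emph{finite abelian category} is a $k$-linear category equivalent, as a $k$-linear category, to the category of finite-dimensional left modules over a finite-dimensional $k$-algebra. A \emph{finite tensor category} is a rigid monoidal category $\mathcal C$ that is a finite abelian category, whose tensor product is $k$-linear in each variable and whose unit object is simple. A \emph{finite left $\mathcal C$-module category} is a left $\mathcal C$-module category $\mathcal M$ that is a finite abelian category and whose action $\otimes\colon\mathcal C\times\mathcal M\to\mathcal M$ is $k$-linear and right exact in each variable. It is \emph{exact} if $P\otimes M$ is projective for every projective $P\in\mathcal C$ and every $M\in\mathcal M$, and \emph{indecomposable} if it is not a direct sum $\mathcal M_1\oplus\mathcal M_2$ of two non-zero full subcategories stable under the action of $\mathcal C$. Let $\mathrm{Rex}(\mathcal M)$ be the category of $k$-linear right exact functors $\mathcal M\to\mathcal M$ and natural transformations, and let $\rho\colon\mathcal C\to\mathrm{Rex}(\mathcal M)$, $\rho(X)(M)=X\otimes M$, be the action functor. \textbf{Theorem.} Let $\mathcal C$ be a finite tensor category and let $\mathcal M$ be a finite left $\mathcal C$-module category. Then $\mathcal M$ has an internal Hom functor, that is, a functor $\underline{\mathrm{Hom}}\colon\mathcal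 M^{\mathrm{op}}\times\mathcal M\to\mathcal C$ with bijections $\mathrm{Hom}_{\mathcal M}(X\otimes M,N)\cong\mathrm{Hom}_{\mathcal C}(X,\underline{\mathrm{Hom}}(M,N))$ natural in $X\in\mathcal C$ and $M,N\in\mathcal M$. For every such functor $\underline{\mathrm{Hom}}$ and every $F\in\mathrm{Rex}(\mathcal M)$, the end of the functor $$\mathcal M^{\mathrm{op}}\times\mathcal M\to\mathcal C,\qquad (M,M')\mapsto\underline{\mathrm{Hom}}(M,F(M'))$$ exists, and the functor $$\rho^{\mathrm{ra}}\colon\mathrm{Rex}(\mathcal M)\to\mathcal C,\qquad F\mapsto\int_{M\in\mathcal M}\underline{\mathrm{Hom}}(M,F(M)),$$ is right adjoint to $\rho$. Moreover: (a) if $\mathcal M$ is exact, then $\rho^{\mathrm{ra}}$ is exact; (b) if $\mathcal M$ is exact and indecomposable, then $\rho^{\mathrm{ra}}$ is faithful. -/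

import Mathlib

open CategoryTheory Limits MonoidalCategory Opposite

universe w v₁ v₂ u₁ u₂

noncomputable section

section FiniteAbelian

open scoped ModuleCat.Algebra

/-- A `k`-linear category is a *finite abelian category* if it is equivalent, as a `k`-linear
category, to the category of finite-dimensional left modules over a finite-dimensional
`k`-algebra `A`. -/
class IsFiniteAbelianCategory (k : Type w) [Field k] (C : Type u₁) [Category.{v₁} C]
    [Preadditive C] [Linear k C] : Prop where
  exists_equivalence : ∃ (A : Type w) (_ : Ring A) (_ : Algebra k A) (_ : Module.Finite k A)
    (e : C ≌ FGModuleCat.{w} A), e.functor.Additive ∧ e.functor.Linear k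

end FiniteAbelian

/-- A *finite tensor category* over `k`: a rigid monoidal category whose underlying category is a
finite abelian category, whose tensor product is `k`-linear in each variable and whose unit
object is simple. -/
class IsFiniteTensorCategory (k : Type w) [Field k] (C : Type u₁) [Category.{v₁} C]
    [Preadditive C] [Linear k C] [MonoidalCategory C] [RigidCategory C] : Prop where
  isFiniteAbelian : IsFiniteAbelianCategory k C
  whiskerLeft_add : ∀ (X : C) {Y Z : C} (f g : Y ⟶ Z), X ◁ (f + g) = X ◁ f + X ◁ g
  whiskerLeft_smul : ∀ (X : C) {Y Z : C} (r : k) (f : Y ⟶ Z), X ◁ (r • f) = r • (X ◁ f)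
  add_whiskerRight : ∀ {Y Z : C} (f g : Y ⟶ Z) (X : C), (f + g) ▷ X = f ▷ X + g ▷ X
  smul_whiskerRight : ∀ (r : k) {Y Z : C} (f : Y ⟶ Z) (X : C), (r • f) ▷ X = r • (f ▷ X)
  simple_unit : Simple (𝟙_ C)

section ModuleCategories

open MonoidalLeftAction

variable (k : Type w) [Field k]
  (C : Type u₁) [Category.{v₁} C] [Preadditive C] [Linear k C] [MonoidalCategory C]
  (M : Type u₂) [Category.{v₂} M] [Preadditive M] [Linear k M] [MonoidalLeftAction C M]

/-- A *finite left `C`-module category*: a left `C`-module category `M` that is a finite abelian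
category and on which the action of `C` is `k`-linear and right exact in each variable. -/
class IsFiniteModuleCategory : Prop where
  isFiniteAbelian : IsFiniteAbelianCategory k M
  additive_actionLeft (X : C) : (actionLeft M X).Additive
  linear_actionLeft (X : C) : (actionLeft M X).Linear k
  rightExact_actionLeft (X : C) : PreservesFiniteColimits (actionLeft M X)
  additive_actionRight (m : M) : (actionRight C m).Additive
  linear_actionRight (m : M) : (actionRight C m).Linear k
  rightExact_actionRight (m : M) : PreservesFiniteColimits (actionRight C m)

/-- A finite left `C`-module category is *exact* if `P ⊙ m` is projective for every projective
object `P` of `C` and every object `m` of `M`. -/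
def IsExactModuleCategory (C : Type u₁) [Category.{v₁} C] [MonoidalCategory C]
    (M : Type u₂) [Category.{v₂} M] [MonoidalLeftAction C M] : Prop :=
  ∀ (P : C) (m : M), Projective P → Projective (P ⊙ₗ m)

/-- `M = M₁ ⊕ M₂` for full (replete) subcategories `M₁`, `M₂` of `M` that are stable under the
action of `C`: there are no non-zero morphisms between the objects of `M₁` and those of `M₂`, and
every object of `M` is a direct sum of an object of `M₁` and an object of `M₂`. -/
structure IsModuleDecomposition (C : Type u₁) [Category.{v₁} C] [MonoidalCategory C]
    {M : Type u₂} [Category.{v₂} M] [Preadditive M] [MonoidalLeftAction C M]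
    (M₁ M₂ : ObjectProperty M) : Prop where
  replete₁ : M₁.IsClosedUnderIsomorphisms
  replete₂ : M₂.IsClosedUnderIsomorphisms
  action₁ (X : C) (m : M) : M₁ m → M₁ (X ⊙ₗ m)
  action₂ (X : C) (m : M) : M₂ m → M₂ (X ⊙ₗ m)
  hom₁₂ {m₁ m₂ : M} (f : m₁ ⟶ m₂) : M₁ m₁ → M₂ m₂ → f = 0
  hom₂₁ {m₁ m₂ : M} (f : m₂ ⟶ m₁) : M₁ m₁ → M₂ m₂ → f = 0
  exists_directSum (m : M) : ∃ (m₁ m₂ : M) (b : BinaryBicone m₁ m₂),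
    M₁ m₁ ∧ M₂ m₂ ∧ Nonempty b.IsBilimit ∧ Nonempty (m ≅ b.pt)

/-- `M` is *indecomposable* if it is not the direct sum of two non-zero `C`-module full
subcategories. -/
def IsIndecomposableModuleCategory (C : Type u₁) [Category.{v₁} C] [MonoidalCategory C]
    (M : Type u₂) [Category.{v₂} M] [Preadditive M] [MonoidalLeftAction C M] : Prop :=
  ∀ M₁ M₂ : ObjectProperty M, IsModuleDecomposition C M₁ M₂ →
    (∀ m, M₁ m → IsZero m) ∨ (∀ m, M₂ m → IsZero m)

/-- The property of an endofunctor of being `k`-linear and right exact. -/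
def linearRightExact (k : Type w) [Field k] (M : Type u₂) [Category.{v₂} M] [Preadditive M]
    [Linear k M] : ObjectProperty (M ⥤ M) :=
  fun F => F.Additive ∧ F.Linear k ∧ PreservesFiniteColimits F

/-- The category `Rex(M)` of `k`-linear right exact endofunctors of `M` and all natural
transformations between them. -/
abbrev Rex (k : Type w) [Field k] (M : Type u₂) [Category.{v₂} M] [Preadditive M]
    [Linear k M] : Type _ :=
  (linearRightExact k M).FullSubcategory

/-- The action functor `ρ : C ⥤ Rex(M)`, `ρ(X)(m) = X ⊙ m`. -/
def actionFunctor [IsFiniteModuleCategory k C M] : C ⥤ Rex k M :=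
  (linearRightExact k M).lift (curriedAction C M) fun X =>
    ⟨IsFiniteModuleCategory.additive_actionLeft (k := k) X,
      IsFiniteModuleCategory.linear_actionLeft X,
      IsFiniteModuleCategory.rightExact_actionLeft (k := k) X⟩

end ModuleCategories

section InternalHom

open MonoidalLeftAction

/-- An *internal Hom functor* for a left `C`-module category `M`: a functor
`(m, n) ↦ iHom(m, n)` from `Mᵒᵖ × M` to `C` (in curried form) together with adjunctions
`(- ⊙ m) ⊣ iHom(m, -)` that are natural in `m`, i.e. bijections
`Hom(X ⊙ m, n) ≃ Hom(X, iHom(m, n))` natural in `X`, `m` and `n`. -/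
structure InternalHom (C : Type u₁) [Category.{v₁} C] [MonoidalCategory C]
    (M : Type u₂) [Category.{v₂} M] [MonoidalLeftAction C M] where
  functor : Mᵒᵖ ⥤ M ⥤ C
  adj : (curriedAction C M).flip ⊣₂ functor

variable {k : Type w} [Field k]
  {C : Type u₁} [Category.{v₁} C] [MonoidalCategory C]
  {M : Type u₂} [Category.{v₂} M] [Preadditive M] [Linear k M] [MonoidalLeftAction C M]

namespace InternalHom

variable (iHom : InternalHom C M)

/-- The functor `Mᵒᵖ × M → C`, `(m, m') ↦ iHom(m, F(m'))`, in curried form, as a functor of `F`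
in `Rex(M)`. -/
def twist : Rex k M ⥤ (Mᵒᵖ ⥤ M ⥤ C) where
  obj F := iHom.functor ⋙ (Functor.whiskeringLeft M M C).obj F.obj
  map α := Functor.whiskerLeft iHom.functor ((Functor.whiskeringLeft M M C).map α.hom)

/-- Provided that the ends exist, the functor `Rex(M) ⥤ C` that sends `F` to the end of
`(m, m') ↦ iHom(m, F(m'))` and a natural transformation to the induced morphism between ends. -/
def endFunctor (h : ∀ F : Rex k M, HasEnd (iHom.twist.obj F)) : Rex k M ⥤ C where
  obj F := haveI := h F; end_ (iHom.twist.obj F)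
  map {F G} α := haveI := h F; haveI := h G; end_.map (iHom.twist.map α)
  map_id F := by
    have := h F
    simp
  map_comp {F G H} α β := by
    have := h F
    have := h G
    have := h H
    simp

end InternalHom

end InternalHom

end

/-! Under the adjunctions defining the internal Hom, a wedge with vertex X over (m, m') ↦ iHom(m,
F(m')) is the same as a natural transformation X ⊙ - ⟶ F. Hence the end is an object representing X
↦ Hom(ρ(X), F), and its existence gives the adjunction. On an abelian category with a progenerator
and finite-dimensional Homs, a left exact functor of the form Hom(L(-), n), finite-dimensional at
the progenerator, is representable (`IsFiniteProgenerator.exists_universal`). Applied to Hom(- ⊙ m,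
n) this yields internal Homs, and applied to Hom(ρ(-), F) it yields the ends.

For (a), only right exactness needs work. Let q be a progenerator of M, E = End q and J the radical
of E. Sending F to the bimodule Hom(q, F(q)) is fully faithful on Rex(M) (`EvalAt.map_surjective`,
`EvalAt.map_injective`), so it is enough that the bimodule B of ρ(P) is projective when P is. The
functor P ⊙ - is exact by duality, and its values are projective because M is exact. The former
makes B flat over E, the latter makes B/JB projective over the opposite of E. Since k is
algebraically closed, E/J is a product of matrix algebras over k, so a one-sided splitting over B/JB
averages to a bimodule splitting; flatness and nilpotence of J lift it to B
(`projective_of_flat_of_quotient_projective`).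

For (b), let R be the right adjoint and α : F ⟶ G non-zero. A non-zero map ρ(P) ⟶ G whose bimodule
map lands in the image of α lifts to F by projectivity, which contradicts R(α) = 0. To find one,
note that in an exact M the objects generated by m and the objects receiving no map from any X ⊙ m
split M into two summands. Indecomposability thus provides a non-zero P ⊙ m ⟶ n for all non-zero m
and n. Such a map, from a quotient of q to the image of a well-chosen element of the bimodule, is
averaged over matrix units into the desired one
(`IsIndecomposableModuleCategory.exists_evalAt_linearMap_ne_zero`). -/

noncomputable section

/-! ### Progenerators of finite abelian categories. -/

section Generators

/-- A projective object `p` such that every object is a quotient of a finite power of `p`. -/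
structure IsFiniteProgenerator {C : Type u₁} [Category.{v₁} C] [Preadditive C] (p : C) : Prop where
  projective : Projective p
  exists_cover (X : C) : ∃ (n : ℕ) (π : Fin n → (p ⟶ X)),
    ∀ {Y : C} (g : X ⟶ Y), (∀ i, π i ≫ g = 0) → g = 0

theorem FGModuleCat.isFiniteProgenerator_of_self (A : Type w) [Ring A] :
    IsFiniteProgenerator (FGModuleCat.of A A) where
  projective := ⟨fun {E X} f g hg => by
    have : Epi ((forget₂ (FGModuleCat A) (ModuleCat.{w} A)).map g) := inferInstance
    have hs := (ModuleCat.epi_iff_surjective _).1 this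
    obtain ⟨h, hh⟩ := Module.projective_lifting_property g.hom.hom f.hom.hom hs
    exact ⟨FGModuleCat.ofHom h, FGModuleCat.hom_ext hh⟩⟩
  exists_cover X := by
    obtain ⟨n, s, hs⟩ := Module.Finite.exists_fin (R := A) (M := X)
    refine ⟨n, fun i => FGModuleCat.ofHom (LinearMap.toSpanSingleton A X (s i)), fun g hg => ?_⟩
    ext x
    have : (⊤ : Submodule A X) ≤ LinearMap.ker g.hom.hom := by
      rw [← hs, Submodule.span_le]
      rintro _ ⟨i, rfl⟩
      have h1 := congr($(hg i).hom.hom (1 : A))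
      have h2 : g.hom.hom (LinearMap.toSpanSingleton A X (s i) 1) = 0 := h1
      rwa [LinearMap.toSpanSingleton_apply, one_smul] at h2
    exact this (Submodule.mem_top (x := x))

open scoped ModuleCat.Algebra in
theorem FGModuleCat.finite_hom (k : Type w) [Field k] (A : Type w) [Ring A] [Algebra k A]
    [Module.Finite k A] (X Y : FGModuleCat.{w} A) : Module.Finite k (X ⟶ Y) := by
  have : IsScalarTower k A X.obj := inferInstance
  have : IsScalarTower k A Y.obj := inferInstance
  have : Module.Finite k X.obj := Module.Finite.trans (R := k) A X
  have : Module.Finite k Y.obj := Module.Finite.trans (R := k) A Y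
  let φ : (X ⟶ Y) →ₗ[k] (X.obj →ₗ[k] Y.obj) :=
    { toFun f := f.hom.hom.restrictScalars k
      map_add' _ _ := rfl
      map_smul' _ _ := rfl }
  refine Module.Finite.of_injective φ fun f g h => ?_
  ext x
  exact congr($h x)

/-- The equation lets the given preadditive structure be replaced by that of the abelian structure,
so that the linear structure stays compatible with it. -/
theorem IsFiniteAbelianCategory.exists_abelian (k : Type w) [Field k] (C : Type u₁)
    [Category.{v₁} C] [i : Preadditive C] [Linear k C] (h : IsFiniteAbelianCategory k C) :
    ∃ a : Abelian C, a.toPreadditive = i := by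
  obtain ⟨A, _, _, _, e, _, _⟩ := h
  have : IsNoetherianRing A := IsNoetherianRing.of_finite k A
  have : HasFiniteProducts C :=
    ⟨fun _ => Adjunction.hasLimitsOfShape_of_equivalence e.functor⟩
  exact ⟨abelianOfEquivalence e.functor, rfl⟩

theorem IsFiniteProgenerator.of_equivalence {C : Type u₁} [Category.{v₁} C] [Preadditive C]
    {D : Type u₂} [Category.{v₂} D] [Preadditive D] (e : C ≌ D) [e.functor.Additive] {p : D}
    (hp : IsFiniteProgenerator p) : IsFiniteProgenerator (e.inverse.obj p) where
  projective := (e.symm.map_projective_iff p).2 hp.projective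
  exists_cover X := by
    obtain ⟨n, π, hπ⟩ := hp.exists_cover (e.functor.obj X)
    refine ⟨n, fun i => (e.symm.toAdjunction.homEquiv _ _).symm (π i), fun g hg => ?_⟩
    apply e.functor.map_injective
    rw [Functor.map_zero]
    refine hπ _ fun i => ?_
    have := hg i
    rw [← Adjunction.homEquiv_naturality_right_symm, Equiv.symm_apply_eq] at this
    refine this.trans ?_
    simp [Adjunction.homEquiv_unit]

theorem IsFiniteAbelianCategory.exists_isFiniteProgenerator (k : Type w) [Field k] (C : Type u₁)
    [Category.{v₁} C] [Preadditive C] [Linear k C] (h : IsFiniteAbelianCategory k C) :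
    ∃ p : C, IsFiniteProgenerator p := by
  obtain ⟨A, _, _, _, e, _, _⟩ := h
  exact ⟨_, (FGModuleCat.isFiniteProgenerator_of_self A).of_equivalence e⟩

theorem IsFiniteAbelianCategory.finite_hom (k : Type w) [Field k] (C : Type u₁)
    [Category.{v₁} C] [Preadditive C] [Linear k C] (h : IsFiniteAbelianCategory k C) (X Y : C) :
    Module.Finite k (X ⟶ Y) := by
  obtain ⟨A, _, _, _, e, _, _⟩ := h
  have := FGModuleCat.finite_hom k A (e.functor.obj X) (e.functor.obj Y)
  exact Module.Finite.of_injective (e.functor.mapLinearMap k) e.functor.map_injective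

end Generators

attribute [local instance] Abelian.hasFiniteBiproducts

/-! ### Representability of left exact functors. -/

section Representability

variable {C : Type u₁} [Category.{v₁} C] [Abelian C] {p : C}

theorem IsFiniteProgenerator.exists_epi (hp : IsFiniteProgenerator p) (X : C) :
    ∃ (n : ℕ) (f : (⨁ fun _ : Fin n => p) ⟶ X), Epi f := by
  obtain ⟨n, π, hπ⟩ := hp.exists_cover X
  refine ⟨n, biproduct.desc π, Preadditive.epi_of_cancel_zero _ fun g hg => hπ g fun i => ?_⟩
  have := congr(biproduct.ι _ i ≫ $hg)
  simpa using this

theorem IsFiniteProgenerator.hom_eq_zero (hp : IsFiniteProgenerator p) {X Y : C} (f : X ⟶ Y)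
    (h : ∀ x : p ⟶ X, x ≫ f = 0) : f = 0 := by
  obtain ⟨n, π, hπ⟩ := hp.exists_cover X
  exact hπ f fun i => h _

theorem IsFiniteProgenerator.epi_of_forall (hp : IsFiniteProgenerator p) {X Y : C} (f : X ⟶ Y)
    (h : ∀ y : p ⟶ Y, ∃ x : p ⟶ X, x ≫ f = y) : Epi f := by
  refine Preadditive.epi_of_cancel_zero _ fun g hg => hp.hom_eq_zero g fun y => ?_
  obtain ⟨x, rfl⟩ := h y
  rw [Category.assoc, hg, comp_zero]

/-- A contravariant functor of the form `X ↦ Hom(L(X), n)` which is left exact and whose value at a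
progenerator is finite-dimensional is representable. -/
theorem IsFiniteProgenerator.exists_universal {k : Type w} [Field k] [Linear k C]
    [∀ X Y : C, Module.Finite k (X ⟶ Y)]
    (hp : IsFiniteProgenerator p) {D : Type u₂} [Category.{v₂} D] [Preadditive D] [Linear k D]
    (L : C ⥤ D) [L.Additive] [L.Linear k] (n : D) [Module.Finite k (L.obj p ⟶ n)]
    (h₁ : ∀ {X Y : C} (f : X ⟶ Y) [Epi f] (u : L.obj Y ⟶ n), L.map f ≫ u = 0 → u = 0)
    (h₂ : ∀ {X Y : C} (f : X ⟶ Y) (u : L.obj Y ⟶ n), L.map f ≫ u = 0 →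
      ∃ v : L.obj (cokernel f) ⟶ n, L.map (cokernel.π f) ≫ v = u) :
    ∃ (Z : C) (x : L.obj Z ⟶ n), ∀ {X : C} (u : L.obj X ⟶ n), ∃! f : X ⟶ Z, L.map f ≫ x = u := by
  have := hp.projective
  obtain ⟨d, h, hh⟩ := Module.Finite.exists_fin (R := k) (M := L.obj p ⟶ n)
  let X₀ : C := ⨁ fun _ : Fin d => p
  -- As the `h i` span, every L(p) ⟶ n is the pullback of x₀ along some p ⟶ X₀. The representing
  -- object is X₀ modulo the maps p ⟶ X₀ that pull x₀ back to zero.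
  let x₀ : L.obj X₀ ⟶ n := ∑ i, L.map (biproduct.π _ i) ≫ h i
  have hx₀ (i : Fin d) : L.map (biproduct.ι (fun _ : Fin d => p) i) ≫ x₀ = h i := by
    simp only [x₀, Preadditive.comp_sum]
    rw [Finset.sum_eq_single i]
    · rw [← Category.assoc, ← L.map_comp, biproduct.ι_π_self, L.map_id, Category.id_comp]
    · intro j _ hj
      rw [← Category.assoc, ← L.map_comp, biproduct.ι_π_ne _ hj.symm, L.map_zero, zero_comp]
    · simp
  have hx₀' (u : L.obj p ⟶ n) : ∃ g : p ⟶ X₀, L.map g ≫ x₀ = u := by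
    have hu : u ∈ Submodule.span k (Set.range h) := by rw [hh]; trivial
    obtain ⟨c, rfl⟩ := (Submodule.mem_span_range_iff_exists_fun k).1 hu
    refine ⟨∑ i, c i • biproduct.ι (fun _ : Fin d => p) i, ?_⟩
    simp only [L.map_sum, L.map_smul, Preadditive.sum_comp, Linear.smul_comp, hx₀]
  let N : Submodule k (p ⟶ X₀) :=
    LinearMap.ker (Linear.leftComp k n (𝟙 _) ∘ₗ Linear.rightComp k _ x₀ ∘ₗ L.mapLinearMap k)
  have hN (g : p ⟶ X₀) : g ∈ N ↔ L.map g ≫ x₀ = 0 := by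
    simp [N]
  obtain ⟨e, r, hr⟩ := Module.Finite.exists_fin (R := k) (M := N)
  let ρ : (⨁ fun _ : Fin e => p) ⟶ X₀ := biproduct.desc fun j => (r j).1
  have hρ : L.map ρ ≫ x₀ = 0 := by
    rw [← Category.id_comp (L.map ρ), ← L.map_id, ← biproduct.total, L.map_sum,
      Preadditive.sum_comp, Preadditive.sum_comp]
    refine Finset.sum_eq_zero fun j _ => ?_
    rw [← L.map_comp, Category.assoc, biproduct.ι_desc, L.map_comp, Category.assoc,
      (hN _).1 (r j).2, comp_zero]
  obtain ⟨x, hx⟩ := h₂ ρ x₀ hρ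
  have key (g : p ⟶ X₀) (hg : L.map g ≫ x₀ = 0) : g ≫ cokernel.π ρ = 0 := by
    have hu : (⟨g, (hN g).2 hg⟩ : N) ∈ Submodule.span k (Set.range r) := by rw [hr]; trivial
    obtain ⟨c, hc⟩ := (Submodule.mem_span_range_iff_exists_fun k).1 hu
    have hc' : g = ∑ j, c j • (r j).1 := by
      have := congr_arg Subtype.val hc
      simpa using this.symm
    rw [hc', Preadditive.sum_comp]
    refine Finset.sum_eq_zero fun j _ => ?_
    have : (r j).1 = biproduct.ι (fun _ : Fin e => p) j ≫ ρ := by simp [ρ]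
    rw [this, Linear.smul_comp, Category.assoc, cokernel.condition, comp_zero, smul_zero]
  refine ⟨cokernel ρ, x, fun {X} u => ?_⟩
  refine existsUnique_of_exists_of_unique ?_ ?_
  · obtain ⟨m, π, hπ⟩ := hp.exists_epi X
    choose g hg using fun i => hx₀' (L.map (biproduct.ι (fun _ : Fin m => p) i ≫ π) ≫ u)
    let G : (⨁ fun _ : Fin m => p) ⟶ X₀ := biproduct.desc g
    have hG : L.map G ≫ x₀ = L.map π ≫ u := by
      rw [← Category.id_comp (L.map G), ← Category.id_comp (L.map π), ← L.map_id,
        ← biproduct.total]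
      simp only [L.map_sum, Preadditive.sum_comp]
      refine Finset.sum_congr rfl fun j _ => ?_
      have := hg j
      rw [← biproduct.ι_desc g j, L.map_comp, L.map_comp, Category.assoc, Category.assoc] at this
      rw [L.map_comp, Category.assoc, Category.assoc, this]
      simp only [Category.assoc]
    -- A map from p to ker π, followed by G, pulls x₀ back to zero, so it dies in the quotient.
    -- Hence G descends along the cover π.
    have hk : kernel.ι π ≫ G ≫ cokernel.π ρ = 0 := by
      refine hp.hom_eq_zero _ fun y => ?_
      rw [← Category.assoc, ← Category.assoc]
      refine key _ ?_
      rw [L.map_comp, Category.assoc, hG, ← L.map_comp_assoc, Category.assoc, kernel.condition,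
        comp_zero, L.map_zero, zero_comp]
    refine ⟨Abelian.epiDesc π (G ≫ cokernel.π ρ) hk, ?_⟩
    rw [← sub_eq_zero]
    refine h₁ π _ ?_
    rw [Preadditive.comp_sub, ← L.map_comp_assoc, Abelian.comp_epiDesc, L.map_comp, Category.assoc,
      hx, hG, sub_self]
  · intro f f' hf hf'
    rw [← sub_eq_zero]
    refine hp.hom_eq_zero _ fun y => ?_
    obtain ⟨g, hg⟩ : ∃ g : p ⟶ X₀, g ≫ cokernel.π ρ = y ≫ (f - f') :=
      ⟨Projective.factorThru (y ≫ (f - f')) (cokernel.π ρ), by simp⟩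
    rw [← hg]
    refine key g ?_
    rw [← hx, ← L.map_comp_assoc, hg, L.map_comp, Category.assoc, L.map_sub,
      Preadditive.sub_comp, hf, hf', sub_self, comp_zero]

end Representability

/-! ### Right exact functors on a category with a progenerator. -/

section RightExact

theorem CategoryTheory.Functor.exists_map_cokernel_π_comp_eq {C : Type u₁} [Category.{v₁} C]
    [Abelian C] {D : Type u₂} [Category.{v₂} D] [HasZeroMorphisms D] (G : C ⥤ D)
    [G.PreservesZeroMorphisms] [PreservesFiniteColimits G] {X Y : C} (f : X ⟶ Y) {n : D}
    (u : G.obj Y ⟶ n) (hu : G.map f ≫ u = 0) :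
    ∃ v : G.obj (cokernel f) ⟶ n, G.map (cokernel.π f) ≫ v = u :=
  ⟨(isColimitOfHasCokernelOfPreservesColimit G f).desc (CokernelCofork.ofπ u hu),
    (isColimitOfHasCokernelOfPreservesColimit G f).fac (CokernelCofork.ofπ u hu)
      WalkingParallelPair.one⟩

/-- The values of a right exact functor are generated by its value at a progenerator. -/
theorem IsFiniteProgenerator.map_hom_eq_zero {C : Type u₁} [Category.{v₁} C] [Abelian C]
    {D : Type u₂} [Category.{v₂} D] [Preadditive D] {p : C} (hp : IsFiniteProgenerator p)
    (G : C ⥤ D) [G.Additive] [PreservesFiniteColimits G] {X : C} {Y : D} (g : G.obj X ⟶ Y)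
    (h : ∀ x : p ⟶ X, G.map x ≫ g = 0) : g = 0 := by
  obtain ⟨n, f, _⟩ := hp.exists_epi X
  have : Epi (G.map f) := inferInstance
  rw [← cancel_epi (G.map f), comp_zero, ← Category.id_comp (G.map f), ← G.map_id,
    ← biproduct.total, G.map_sum, Preadditive.sum_comp, Preadditive.sum_comp]
  refine Finset.sum_eq_zero fun i _ => ?_
  rw [G.map_comp, Category.assoc, Category.assoc, ← Category.assoc (G.map (biproduct.ι _ i)),
    ← G.map_comp, h, comp_zero]

end RightExact

/-! ### Existence of the internal Hom. -/

section InternalHomExistence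

open MonoidalLeftAction

variable {k : Type w} [Field k]
  {C : Type u₁} [Category.{v₁} C] [Abelian C] [Linear k C] [MonoidalCategory C]
  {M : Type u₂} [Category.{v₂} M] [MonoidalLeftAction C M]

/-- An internal Hom functor assembled from right adjoints of the functors `- ⊙ m`. -/
def InternalHom.ofIsLeftAdjoint (h : ∀ m : M, (actionRight C m).IsLeftAdjoint) :
    InternalHom C M where
  functor :=
    { obj m := (actionRight C m.unop).rightAdjoint
      map {m n} f := conjugateEquiv (Adjunction.ofIsLeftAdjoint (actionRight C m.unop))
        (Adjunction.ofIsLeftAdjoint (actionRight C n.unop)) ((curriedAction C M).flip.map f.unop)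
      map_id m := by
        rw [unop_id, CategoryTheory.Functor.map_id]
        exact conjugateEquiv_id _
      map_comp f g := by
        rw [unop_comp, Functor.map_comp, conjugateEquiv_comp] }
  adj :=
    { adj m := Adjunction.ofIsLeftAdjoint (actionRight C m)
      unit_whiskerRight_map f := by
        ext X
        exact (unit_conjugateEquiv _ _ _ _).symm }

theorem exists_internalHom [Preadditive M] [Linear k M] [∀ X Y : C, Module.Finite k (X ⟶ Y)]
    [∀ X Y : M, Module.Finite k (X ⟶ Y)]
    [IsFiniteModuleCategory k C M] {p : C} (hp : IsFiniteProgenerator p) :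
    Nonempty (InternalHom C M) := by
  refine ⟨InternalHom.ofIsLeftAdjoint fun m => ?_⟩
  have : (actionRight C m).Additive := IsFiniteModuleCategory.additive_actionRight k m
  have : (actionRight C m).Linear k := IsFiniteModuleCategory.linear_actionRight m
  have : PreservesFiniteColimits (actionRight C m) :=
    IsFiniteModuleCategory.rightExact_actionRight k m
  have (n : M) := hp.exists_universal (k := k) (actionRight C m) n
    (fun f _ u hu => by
      rwa [← cancel_epi ((actionRight C m).map f), comp_zero])
    (fun f u hu => (actionRight C m).exists_map_cokernel_π_comp_eq f u hu)
  choose Z x hx using this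
  let e (X : C) (n : M) : ((actionRight C m).obj X ⟶ n) ≃ (X ⟶ Z n) :=
    (Equiv.ofBijective (fun f : X ⟶ Z n => (actionRight C m).map f ≫ x n)
      ⟨fun f g h => (hx n _).unique h rfl, fun u => (hx n u).exists⟩).symm
  refine (Adjunction.adjunctionOfEquivRight e fun X' X n f g => ?_).isLeftAdjoint
  refine (Equiv.symm_apply_eq _).2 ?_
  have h₁ : (actionRight C m).map (e X n g) ≫ x n = g := (e X n).symm_apply_apply g
  change _ = (actionRight C m).map (f ≫ e X n g) ≫ x n
  rw [Functor.map_comp, Category.assoc, h₁]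

end InternalHomExistence

/-! ### Wedges as natural transformations, and the adjunction. -/

section Ends

open MonoidalLeftAction

variable {k : Type w} [Field k]
  {C : Type u₁} [Category.{v₁} C] [Preadditive C] [Linear k C] [MonoidalCategory C]
  {M : Type u₂} [Category.{v₂} M] [Preadditive M] [Linear k M] [MonoidalLeftAction C M]
  [IsFiniteModuleCategory k C M]

instance actionFunctor_additive : (actionFunctor k C M).Additive where
  map_add {X Y f g} := by
    ext m
    exact (IsFiniteModuleCategory.additive_actionRight (C := C) k m).map_add

instance actionFunctor_linear : (actionFunctor k C M).Linear k where
  map_smul f r := by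
    ext m
    exact (IsFiniteModuleCategory.linear_actionRight (C := C) m).map_smul f r

namespace InternalHom

variable (iHom : InternalHom C M)

/-- The wedge condition is naturality of t: both sides are transposes of the same morphism X ⊙ m ⟶
F(n). -/
theorem homEquiv_app_comp_twist {X : C} {F : Rex k M} (t : (actionFunctor k C M).obj X ⟶ F)
    {m n : M} (f : m ⟶ n) :
    iHom.adj.homEquiv (t.hom.app m) ≫ ((iHom.twist.obj F).obj (op m)).map f =
      iHom.adj.homEquiv (t.hom.app n) ≫ ((iHom.twist.obj F).map f.op).app n := by
  have h₁ := iHom.adj.homEquiv_naturality_three (X₁ := m) (X₂ := X) (F.obj.map f) (t.hom.app m)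
  have h₂ := iHom.adj.homEquiv_naturality_one (X₂ := X) f (t.hom.app n)
  have h₃ := t.hom.naturality f
  refine h₁.symm.trans (Eq.trans ?_ h₂)
  exact congr_arg _ h₃.symm

/-- The natural transformation `X ⊙ - ⟶ F` corresponding to a wedge with vertex `X`. -/
def homOfWedge {X : C} {F : Rex k M} (g : ∀ m : M, X ⟶ ((iHom.twist.obj F).obj (op m)).obj m)
    (hg : ∀ ⦃m n : M⦄ (f : m ⟶ n), g m ≫ ((iHom.twist.obj F).obj (op m)).map f =
      g n ≫ ((iHom.twist.obj F).map f.op).app n) :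
    (actionFunctor k C M).obj X ⟶ F :=
  ObjectProperty.homMk
    { app m := (iHom.adj.homEquiv (X₁ := m)).symm (g m)
      naturality m n f := by
        have h₁ := iHom.adj.homEquiv_symm_naturality_three (X₁ := m) (X₂ := X) (F.obj.map f) (g m)
        have h₂ := iHom.adj.homEquiv_symm_naturality_one (X₂ := X) f (g n)
        refine Eq.trans h₂.symm (Eq.trans ?_ h₁)
        exact congr_arg _ (hg f).symm }

theorem hasEnd_of_universal (F : Rex k M) {Z : C} (x : (actionFunctor k C M).obj Z ⟶ F)
    (hx : ∀ {X : C} (u : (actionFunctor k C M).obj X ⟶ F),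
      ∃! f : X ⟶ Z, (actionFunctor k C M).map f ≫ x = u) :
    HasEnd (iHom.twist.obj F) := by
  have key {X : C} (f : X ⟶ Z) (m : M) : iHom.adj.homEquiv (X₁ := m)
      (((actionFunctor k C M).map f ≫ x).hom.app m) = f ≫ iHom.adj.homEquiv (x.hom.app m) :=
    iHom.adj.homEquiv_naturality_two f (x.hom.app m)
  have hE (E : Wedge (iHom.twist.obj F)) := hx (iHom.homOfWedge (fun m => E.ι m)
    fun _ _ f => Wedge.condition E f)
  refine HasLimit.mk ⟨Wedge.mk Z (fun m => iHom.adj.homEquiv (X₁ := m) (x.hom.app m))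
    fun _ _ f => iHom.homEquiv_app_comp_twist x f,
    Multifork.IsLimit.mk _ (fun E => (hE E).choose) (fun E m => ?_) (fun E f hf => ?_)⟩
  · refine (key _ m).symm.trans ?_
    rw [(hE E).choose_spec.1]
    exact Equiv.apply_symm_apply _ _
  · refine (hE E).choose_spec.2 f ?_
    ext m
    refine (Equiv.eq_symm_apply _).2 ?_
    exact (key f m).trans (hf m)

/-- Natural transformations `X ⊙ - ⟶ F` correspond to morphisms from `X` to the end of
`(m, m') ↦ iHom(m, F(m'))`. -/
def homEquivEnd (X : C) (F : Rex k M) [HasEnd (iHom.twist.obj F)] :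
    ((actionFunctor k C M).obj X ⟶ F) ≃ (X ⟶ end_ (iHom.twist.obj F)) where
  toFun t := end_.lift (fun m => iHom.adj.homEquiv (X₁ := m) (t.hom.app m))
    fun _ _ f => iHom.homEquiv_app_comp_twist t f
  invFun g := iHom.homOfWedge (fun m => g ≫ end_.π (iHom.twist.obj F) m)
    fun m n f => by rw [Category.assoc, Category.assoc, end_.condition]
  left_inv t := by
    ext m
    refine (Equiv.symm_apply_eq _).2 ?_
    exact end_.lift_π _ _ _
  right_inv g := by
    refine end_.hom_ext fun m => ?_
    refine (end_.lift_π _ _ _).trans ?_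
    exact Equiv.apply_symm_apply _ _

theorem homEquivEnd_comp_π {X : C} {F : Rex k M} [HasEnd (iHom.twist.obj F)]
    (t : (actionFunctor k C M).obj X ⟶ F) (m : M) :
    iHom.homEquivEnd X F t ≫ end_.π (iHom.twist.obj F) m =
      iHom.adj.homEquiv (X₁ := m) (t.hom.app m) :=
  end_.lift_π _ (fun _ _ f => iHom.homEquiv_app_comp_twist t f) _

theorem homEquivEnd_naturality_left {X X' : C} {F : Rex k M} [HasEnd (iHom.twist.obj F)]
    (f : X ⟶ X') (t : (actionFunctor k C M).obj X' ⟶ F) :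
    iHom.homEquivEnd X F ((actionFunctor k C M).map f ≫ t) = f ≫ iHom.homEquivEnd X' F t := by
  refine end_.hom_ext fun m => ?_
  rw [Category.assoc, homEquivEnd_comp_π, homEquivEnd_comp_π]
  exact iHom.adj.homEquiv_naturality_two (X₁ := m) f _

theorem homEquivEnd_naturality_right {X : C} {F G : Rex k M} [HasEnd (iHom.twist.obj F)]
    [HasEnd (iHom.twist.obj G)] (t : (actionFunctor k C M).obj X ⟶ F) (α : F ⟶ G) :
    iHom.homEquivEnd X G (t ≫ α) = iHom.homEquivEnd X F t ≫ end_.map (iHom.twist.map α) := by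
  refine end_.hom_ext fun m => ?_
  rw [Category.assoc, end_.map_π, ← Category.assoc, homEquivEnd_comp_π, homEquivEnd_comp_π]
  exact iHom.adj.homEquiv_naturality_three (X₁ := m) (α.hom.app m) (t.hom.app m)

/-- The action functor is left adjoint to the functor sending `F` to the end of
`(m, m') ↦ iHom(m, F(m'))`. -/
def actionFunctorAdjEndFunctor (h : ∀ F : Rex k M, HasEnd (iHom.twist.obj F)) :
    actionFunctor k C M ⊣ iHom.endFunctor h :=
  Adjunction.mkOfHomEquiv
    { homEquiv X F := haveI := h F; iHom.homEquivEnd X F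
      homEquiv_naturality_left_symm {X X' F} f g := by
        have := h F
        refine (Equiv.symm_apply_eq _).2 ?_
        refine Eq.trans ?_ (iHom.homEquivEnd_naturality_left f _).symm
        exact congr_arg (f ≫ ·) (Equiv.apply_symm_apply _ _).symm
      homEquiv_naturality_right {X F G} t α :=
        haveI := h F
        haveI := h G
        iHom.homEquivEnd_naturality_right t α }

end InternalHom

end Ends

/-! ### Lifting splittings along a nilpotent ideal. -/

section Nilpotent

/-- Induction on the exponent of I that kills the kernel. Hypothesis `h₁` is the trace of flatness
of B, a Tor vanishing; `h₂` says that every surjection onto B splits modulo I. -/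
theorem exists_section_of_pow_smul_ker_eq_bot {T : Type u₁} [Ring T] (I : Ideal T) {B : Type u₂}
    [AddCommGroup B] [Module T B]
    (h₁ : ∀ (V : Type u₂) [AddCommGroup V] [Module T V] (π : V →ₗ[T] B), Function.Surjective π →
      LinearMap.ker π ⊓ I • ⊤ ≤ I • LinearMap.ker π)
    (h₂ : ∀ (V : Type u₂) [AddCommGroup V] [Module T V] (π : V →ₗ[T] B) (_ : Function.Surjective π),
      ∃ s : (B ⧸ (I • ⊤ : Submodule T B)) →ₗ[T] (V ⧸ (I • ⊤ : Submodule T V)),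
        ∀ y v, Submodule.Quotient.mk v = s y → Submodule.Quotient.mk (π v) = y) (n : ℕ) :
    ∀ (V : Type u₂) [AddCommGroup V] [Module T V] (π : V →ₗ[T] B), Function.Surjective π →
      (I ^ n) • LinearMap.ker π = ⊥ → ∃ s : B →ₗ[T] V, π ∘ₗ s = LinearMap.id := by
  induction n with
  | zero =>
    intro V _ _ π hπ h
    rw [Submodule.pow_zero, Ideal.one_eq_top, Submodule.top_smul] at h
    let e := LinearEquiv.ofBijective π ⟨LinearMap.ker_eq_bot.1 h, hπ⟩
    exact ⟨e.symm.toLinearMap, LinearMap.ext fun b => e.apply_symm_apply b⟩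
  | succ n ih =>
    intro V _ _ π hπ h
    obtain ⟨s, hs⟩ := h₂ V π hπ
    -- The preimage of the range of s still maps onto B, but its kernel lies in I • ker π, so a
    -- smaller exponent suffices for it.
    let V' : Submodule T V := (LinearMap.range s).comap (Submodule.mkQ _)
    have hIV : (I • ⊤ : Submodule T V) ≤ V' := fun v hv => by
      refine ⟨0, ?_⟩
      rw [map_zero, eq_comm]
      exact (Submodule.Quotient.mk_eq_zero _).2 hv
    have hmap : (I • ⊤ : Submodule T V).map π = I • ⊤ := by
      rw [Submodule.map_smul'', Submodule.map_top, LinearMap.range_eq_top.2 hπ]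
    have hsurj : Function.Surjective (π ∘ₗ V'.subtype) := fun b => by
      obtain ⟨v, hv⟩ := Submodule.Quotient.mk_surjective _ (s (Submodule.Quotient.mk b))
      have hb : π v - b ∈ (I • ⊤ : Submodule T V).map π := by
        rw [hmap]
        exact (Submodule.Quotient.eq _).1 (hs _ v hv)
      obtain ⟨x, hx, hxb⟩ := hb
      refine ⟨⟨v - x, V'.sub_mem ⟨_, hv.symm⟩ (hIV hx)⟩, ?_⟩
      simp [hxb]
    have hker : (LinearMap.ker (π ∘ₗ V'.subtype)).map V'.subtype ≤ I • LinearMap.ker π := by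
      rintro _ ⟨⟨v, y, hy⟩, hv, rfl⟩
      have hv' : π v = 0 := hv
      refine h₁ V π hπ ⟨hv', ?_⟩
      have : y = 0 := by
        rw [← hs y v hy.symm, hv', Submodule.Quotient.mk_zero]
      rw [this, map_zero] at hy
      exact (Submodule.Quotient.mk_eq_zero _).1 hy.symm
    obtain ⟨t, ht⟩ := ih V' (π ∘ₗ V'.subtype) hsurj (by
      rw [← (Submodule.map_injective_of_injective V'.injective_subtype).eq_iff,
        Submodule.map_smul'', Submodule.map_bot, eq_bot_iff, ← h, Submodule.pow_succ,
        Submodule.mul_smul]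
      exact Submodule.smul_mono le_rfl hker)
    exact ⟨V'.subtype ∘ₗ t, by rw [← LinearMap.comp_assoc, ht]⟩

end Nilpotent

/-! ### Matrix units modulo the Jacobson radical. -/

section MatrixUnits

theorem Matrix.pi_single_single_zero_mul {R ι : Type*} [CommRing R] [DecidableEq ι] {d : ι → ℕ}
    [∀ i, NeZero (d i)] (M : Π i, Matrix (Fin (d i)) (Fin (d i)) R) (i : ι) (j : Fin (d i)) :
    Pi.single (M := fun i => Matrix (Fin (d i)) (Fin (d i)) R) i (Matrix.single 0 j 1) * M =
      ∑ m, M i j m • Pi.single i (Matrix.single 0 m 1) := by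
  ext i' a b
  rw [Finset.sum_apply, Matrix.sum_apply]
  by_cases h : i' = i
  · subst h
    by_cases h : a = 0
    · subst h
      simp [Matrix.single_apply]
    · simp [h, Ne.symm h]
  · simp [h]

theorem Matrix.mul_pi_single_single_zero {R ι : Type*} [CommRing R] [DecidableEq ι] {d : ι → ℕ}
    [∀ i, NeZero (d i)] (M : Π i, Matrix (Fin (d i)) (Fin (d i)) R) (i : ι) (j : Fin (d i)) :
    M * Pi.single (M := fun i => Matrix (Fin (d i)) (Fin (d i)) R) i (Matrix.single j 0 1) =
      ∑ m, M i m j • Pi.single i (Matrix.single m 0 1) := by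
  ext i' a b
  rw [Finset.sum_apply, Matrix.sum_apply]
  by_cases h : i' = i
  · subst h
    by_cases h : b = 0
    · subst h
      simp [Matrix.single_apply]
    · simp [h, Ne.symm h]
  · simp [h]

variable (k : Type w) [Field k] (E : Type u₁) [Ring E] [Algebra k E]

/-- Matrix units `u i j = e_{j0}` and `w i j = e_{0j}` of the blocks of a split semisimple
quotient `E ⧸ J`, lifted to `E`. -/
structure MatrixUnitsModJacobson where
  n : ℕ
  d : Fin n → ℕ
  d_pos : ∀ i, NeZero (d i)
  u : ∀ i, Fin (d i) → E
  w : ∀ i, Fin (d i) → E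
  χ : E → ∀ i, Matrix (Fin (d i)) (Fin (d i)) k
  w_mul (a : E) i j : w i j * a - ∑ m, χ a i j m • w i m ∈ Ring.jacobson E
  mul_u (a : E) i j : a * u i j - ∑ m, χ a i m j • u i m ∈ Ring.jacobson E
  sum_u_mul_w : ∑ i, ∑ j, u i j * w i j - 1 ∈ Ring.jacobson E
  zero_mul_w i j : w i 0 * w i j - w i j ∈ Ring.jacobson E
  w_mul_zero i j : w i j * w i 0 - (if j = 0 then w i 0 else 0) ∈ Ring.jacobson E
  u_zero i : u i 0 - w i 0 ∈ Ring.jacobson E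

/-- This is where algebraic closedness enters: by Wedderburn, E/J is a product of matrix algebras
over k itself. All relations hold in the quotient, hence modulo J after lifting. -/
theorem exists_matrixUnitsModJacobson [IsAlgClosed k] [Module.Finite k E] :
    Nonempty (MatrixUnitsModJacobson k E) := by
  have : IsArtinianRing E := IsArtinianRing.of_finite k E
  have : Module.Finite k (E ⧸ Ring.jacobson E) :=
    Module.Finite.of_surjective (Ideal.Quotient.mkₐ k (Ring.jacobson E)).toLinearMap
      Ideal.Quotient.mk_surjective
  obtain ⟨n, d, hd, ⟨e⟩⟩ := IsSemisimpleRing.exists_algEquiv_pi_matrix_of_isAlgClosed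
    k (E ⧸ Ring.jacobson E)
  let Φ : E →ₐ[k] (Π i, Matrix (Fin (d i)) (Fin (d i)) k) :=
    e.toAlgHom.comp (Ideal.Quotient.mkₐ k (Ring.jacobson E))
  have hΦ : Function.Surjective Φ := e.surjective.comp Ideal.Quotient.mk_surjective
  have hJ (x : E) (hx : Φ x = 0) : x ∈ Ring.jacobson E :=
    Ideal.Quotient.eq_zero_iff_mem.1 (e.injective (hx.trans (map_zero e).symm))
  choose u hu using fun i (j : Fin (d i)) => hΦ (Pi.single i (Matrix.single j 0 1))
  choose w hw using fun i (j : Fin (d i)) => hΦ (Pi.single i (Matrix.single 0 j 1))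
  refine ⟨{ n := n, d := d, d_pos := hd, u := u, w := w, χ := fun a => Φ a
            w_mul := fun a i j => hJ _ ?_
            mul_u := fun a i j => hJ _ ?_
            sum_u_mul_w := hJ _ ?_
            zero_mul_w := fun i j => hJ _ ?_
            w_mul_zero := fun i j => hJ _ ?_
            u_zero := fun i => hJ _ ?_ }⟩
  · rw [map_sub, map_mul, map_sum, sub_eq_zero]
    simp only [map_smul, hw]
    rw [Matrix.pi_single_single_zero_mul]
  · rw [map_sub, map_mul, map_sum, sub_eq_zero]
    simp only [map_smul, hu]
    rw [Matrix.mul_pi_single_single_zero]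
  · rw [map_sub, map_one, map_sum, sub_eq_zero]
    simp only [map_sum, map_mul, hu, hw, ← Pi.single_mul, Matrix.single_mul_single_same, mul_one]
    ext i' : 1
    rw [Finset.sum_apply, Finset.sum_eq_single i']
    · rw [Finset.sum_apply]
      simp [Matrix.sum_single_one]
    · intro j _ hj
      rw [Finset.sum_apply]
      simp [hj.symm]
    · simp
  · rw [map_sub, map_mul, hw, hw, ← Pi.single_mul]; simp
  · rw [map_sub, map_mul, hw, hw, ← Pi.single_mul]
    split_ifs with h
    · subst h; simp [hw]
    · simp [h]
  · rw [map_sub, hu, hw, sub_self]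

variable {k E}

namespace MatrixUnitsModJacobson

variable (U : MatrixUnitsModJacobson k E) {X Y : Type*} [AddCommGroup X] [AddCommGroup Y]
  [Module E X] [Module E Y] [Module k X] [Module k Y] [IsScalarTower k E X] [IsScalarTower k E Y]

/-- The average of a `k`-linear map over a block of matrix units. -/
def average (i : Fin U.n) (f : X →ₗ[k] Y) (x : X) : Y := ∑ j, U.u i j • f (U.w i j • x)

/-- The tensor ∑ u_j ⊗ w_j commutes with E modulo J, and the hypotheses on f make J invisible on
both sides. With χ the matrix of a, both sides expand to ∑ χ_jm u_j f(w_m x). -/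
theorem average_smul (f : X →ₗ[k] Y) (hX : ∀ r ∈ Ring.jacobson E, ∀ x, f (r • x) = 0)
    (hY : ∀ r ∈ Ring.jacobson E, ∀ x, r • f x = 0) (i : Fin U.n) (a : E) (x : X) :
    U.average i f (a • x) = a • U.average i f x := by
  have hl (j : Fin (U.d i)) : f (U.w i j • a • x) = ∑ m, U.χ a i j m • f (U.w i m • x) := by
    have := hX _ (U.w_mul a i j) x
    rw [sub_smul, map_sub, sub_eq_zero, Finset.sum_smul, map_sum] at this
    rw [← mul_smul, this]
    exact Finset.sum_congr rfl fun m _ => by rw [smul_assoc, map_smul]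
  have hr (j : Fin (U.d i)) (y : X) : a • U.u i j • f y = ∑ m, U.χ a i m j • U.u i m • f y := by
    have := hY _ (U.mul_u a i j) y
    rw [sub_smul, sub_eq_zero, Finset.sum_smul] at this
    rw [← mul_smul, this]
    exact Finset.sum_congr rfl fun m _ => by rw [smul_assoc]
  simp only [average, hl, Finset.smul_sum, hr]
  rw [Finset.sum_comm]
  refine Finset.sum_congr rfl fun j _ => Finset.sum_congr rfl fun m _ => ?_
  rw [smul_algebra_smul_comm]

end MatrixUnitsModJacobson

end MatrixUnits

/-! ### Bimodules: flatness and splittings modulo the radical. -/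

section Bimodules

open TensorProduct

variable (k : Type w) [Field k] (E : Type u₁) [Ring E] [Algebra k E] (A : Type u₁) [Ring A]
  [Algebra k A]

/-- The left ideal of `E ⊗ A` generated by the Jacobson radical of `E`. -/
def jacobsonIdeal : Ideal (E ⊗[k] A) :=
  Ideal.span ((fun a : E => a ⊗ₜ[k] (1 : A)) '' (Ring.jacobson E : Set E))

variable {E}

theorem tmul_one_mem_jacobsonIdeal {a : E} (ha : a ∈ Ring.jacobson E) :
    a ⊗ₜ[k] (1 : A) ∈ jacobsonIdeal k E A :=
  Ideal.subset_span ⟨a, ha, rfl⟩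

/-- The identity (b ⊗ 1)(e ⊗ a) = (1 ⊗ a)(be ⊗ 1) makes the left ideal generated by K two-sided. -/
theorem mul_mem_span_tmul_one {K : Ideal E} [K.IsTwoSided] {x : E ⊗[k] A}
    (hx : x ∈ Ideal.span ((fun a : E => a ⊗ₜ[k] (1 : A)) '' (K : Set E))) (t : E ⊗[k] A) :
    x * t ∈ Ideal.span ((fun a : E => a ⊗ₜ[k] (1 : A)) '' (K : Set E)) := by
  induction t with
  | zero => simp
  | add t s ht hs => rw [mul_add]; exact add_mem ht hs
  | tmul e a =>
    induction hx using Submodule.span_induction with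
    | zero => simp
    | add x y _ _ hx hy => rw [add_mul]; exact add_mem hx hy
    | smul s x _ hx => rw [smul_eq_mul, mul_assoc]; exact Ideal.mul_mem_left _ _ hx
    | mem x hx =>
      obtain ⟨b, hb, rfl⟩ := hx
      have : b ⊗ₜ[k] (1 : A) * e ⊗ₜ a = (1 : E) ⊗ₜ a * (b * e) ⊗ₜ (1 : A) := by simp
      rw [this]
      exact Ideal.mul_mem_left _ _ (Ideal.subset_span ⟨_, K.mul_mem_right _ hb, rfl⟩)

theorem jacobsonIdeal_pow_le (n : ℕ) : jacobsonIdeal k E A ^ n ≤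
    Ideal.span ((fun a : E => a ⊗ₜ[k] (1 : A)) '' ((Ring.jacobson E ^ n : Ideal E) : Set E)) := by
  induction n with
  | zero =>
    have : (1 : E ⊗[k] A) ∈ Ideal.span ((fun a : E => a ⊗ₜ[k] (1 : A)) ''
        ((Ring.jacobson E ^ 0 : Ideal E) : Set E)) :=
      Ideal.subset_span ⟨1, by rw [Submodule.pow_zero, Ideal.one_eq_top]; trivial, rfl⟩
    rw [(Ideal.eq_top_iff_one _).2 this]
    exact le_top
  | succ n ih =>
    rw [Submodule.pow_succ, Ideal.mul_le]
    intro x hx y hy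
    replace hx := ih hx
    induction hy using Submodule.span_induction generalizing x with
    | zero => simp
    | add y z _ _ hy hz => rw [mul_add]; exact add_mem (hy x hx) (hz x hx)
    | smul s y _ hy =>
      rw [smul_eq_mul, ← mul_assoc]
      exact hy _ (mul_mem_span_tmul_one k A hx s)
    | mem y hy =>
      obtain ⟨a, ha, rfl⟩ := hy
      induction hx using Submodule.span_induction with
      | zero => simp
      | add x y _ _ hx hy => rw [add_mul]; exact add_mem hx hy
      | smul s x _ hx => rw [smul_eq_mul, mul_assoc]; exact Ideal.mul_mem_left _ _ hx
      | mem x hx =>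
        obtain ⟨b, hb, rfl⟩ := hx
        refine Ideal.subset_span ⟨b * a, ?_, by simp⟩
        rw [Submodule.pow_succ]
        exact Ideal.mul_mem_mul hb ha

theorem exists_jacobsonIdeal_pow_eq_bot [Module.Finite k E] :
    ∃ n, jacobsonIdeal k E A ^ n = ⊥ := by
  have : IsArtinianRing E := IsArtinianRing.of_finite k E
  obtain ⟨n, hn⟩ := IsSemiprimaryRing.isNilpotent (R := E)
  refine ⟨n, eq_bot_iff.2 ((jacobsonIdeal_pow_le k A n).trans ?_)⟩
  rw [hn, Ideal.span_le]
  rintro _ ⟨a, ha, rfl⟩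
  have : a = 0 := ha
  simp [this]

variable {k A}

/-- Since the family spans the radical over k, coefficients are scalars and can be absorbed into the
vectors. -/
theorem exists_eq_sum_of_mem_jacobsonIdeal_smul_top {n : ℕ} {j : Fin n → E}
    (hj : Submodule.span k (Set.range j) = (Ring.jacobson E).restrictScalars k)
    {V : Type*} [AddCommGroup V] [Module (E ⊗[k] A) V] {x : V}
    (hx : x ∈ jacobsonIdeal k E A • (⊤ : Submodule (E ⊗[k] A) V)) :
    ∃ v : Fin n → V, x = ∑ i, (j i ⊗ₜ[k] (1 : A)) • v i := by
  have hmem (i : Fin n) : j i ∈ Ring.jacobson E := by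
    have : j i ∈ Submodule.span k (Set.range j) := Submodule.subset_span ⟨i, rfl⟩
    rwa [hj] at this
  have hsmul (a : E) (ha : a ∈ Ring.jacobson E) (x : V) :
      ∃ v : Fin n → V, (a ⊗ₜ[k] (1 : A)) • x = ∑ i, (j i ⊗ₜ[k] (1 : A)) • v i := by
    have : a ∈ Submodule.span k (Set.range j) := by rw [hj]; exact ha
    obtain ⟨c, rfl⟩ := (Submodule.mem_span_range_iff_exists_fun k).1 this
    refine ⟨fun i => ((1 : E) ⊗ₜ[k] algebraMap k A (c i)) • x, ?_⟩
    rw [TensorProduct.sum_tmul, Finset.sum_smul]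
    refine Finset.sum_congr rfl fun i _ => ?_
    rw [← mul_smul]
    simp [Algebra.algebraMap_eq_smul_one, TensorProduct.smul_tmul]
  have hadd (x y : V) : (∃ v : Fin n → V, x = ∑ i, (j i ⊗ₜ[k] (1 : A)) • v i) →
      (∃ v : Fin n → V, y = ∑ i, (j i ⊗ₜ[k] (1 : A)) • v i) →
      ∃ v : Fin n → V, x + y = ∑ i, (j i ⊗ₜ[k] (1 : A)) • v i := by
    rintro ⟨v, rfl⟩ ⟨v', rfl⟩
    exact ⟨v + v', by simp [smul_add, Finset.sum_add_distrib]⟩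
  have hzero : ∃ v : Fin n → V, 0 = ∑ i, (j i ⊗ₜ[k] (1 : A)) • v i := ⟨0, by simp⟩
  refine Submodule.smul_induction_on hx (fun r hr v _ => ?_) hadd
  induction hr using Submodule.span_induction generalizing v with
  | zero => simpa using hzero
  | add x y _ _ hx hy => rw [add_smul]; exact hadd _ _ (hx v trivial) (hy v trivial)
  | mem x hx =>
    obtain ⟨a, ha, rfl⟩ := hx
    exact hsmul a ha v
  | smul t r _ hr =>
    obtain ⟨v', hv'⟩ := hr v trivial
    rw [smul_eq_mul, mul_smul, hv']
    induction t with
    | zero => simpa using hzero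
    | add t s ht hs => rw [add_smul]; exact hadd _ _ ht hs
    | tmul e a =>
      rw [Finset.smul_sum]
      refine Finset.sum_induction _
        (fun x => ∃ v : Fin n → V, x = ∑ i, (j i ⊗ₜ[k] (1 : A)) • v i) hadd hzero fun i _ => ?_
      have : e ⊗ₜ[k] a * j i ⊗ₜ (1 : A) = (e * j i) ⊗ₜ (1 : A) * (1 : E) ⊗ₜ a := by simp
      rw [← mul_smul, this, mul_smul]
      exact hsmul _ (Ideal.mul_mem_left _ _ (hmem i)) _

/-- Hypothesis `hflat` is the equational criterion for flatness, restricted to relations with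
coefficients j_i. If ∑ j_i v_i maps to zero, the relation among the π(v_i) is trivial; lifting its
witnesses to V and subtracting ∑ j_i a_il w_l = 0 moves each v_i into the kernel. -/
theorem ker_inf_jacobsonIdeal_smul_top_le {n : ℕ} {j : Fin n → E}
    (hj : Submodule.span k (Set.range j) = (Ring.jacobson E).restrictScalars k)
    {B : Type*} [AddCommGroup B] [Module (E ⊗[k] A) B]
    (hflat : ∀ b : Fin n → B, ∑ i, (j i ⊗ₜ[k] (1 : A)) • b i = 0 →
      ∃ (m : ℕ) (c : Fin m → B) (a : Fin n → Fin m → E),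
        (∀ i, b i = ∑ l, (a i l ⊗ₜ[k] (1 : A)) • c l) ∧ ∀ l, ∑ i, j i * a i l = 0)
    {V : Type*} [AddCommGroup V] [Module (E ⊗[k] A) V] (π : V →ₗ[E ⊗[k] A] B)
    (hπ : Function.Surjective π) :
    LinearMap.ker π ⊓ jacobsonIdeal k E A • ⊤ ≤ jacobsonIdeal k E A • LinearMap.ker π := by
  have hmem (i : Fin n) : j i ∈ Ring.jacobson E := by
    have : j i ∈ Submodule.span k (Set.range j) := Submodule.subset_span ⟨i, rfl⟩
    rwa [hj] at this
  rintro x ⟨hx, hx'⟩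
  obtain ⟨v, rfl⟩ := exists_eq_sum_of_mem_jacobsonIdeal_smul_top hj hx'
  obtain ⟨m, c, a, hb, ha⟩ := hflat (fun i => π (v i)) (by simpa using hx)
  choose w hw using fun l => hπ (c l)
  have h₁ : ∑ i, (j i ⊗ₜ[k] (1 : A)) • ∑ l, (a i l ⊗ₜ[k] (1 : A)) • w l = 0 := by
    simp only [Finset.smul_sum]
    rw [Finset.sum_comm]
    refine Finset.sum_eq_zero fun l _ => ?_
    simp only [← mul_smul, Algebra.TensorProduct.tmul_mul_tmul, mul_one]
    rw [← Finset.sum_smul, ← TensorProduct.sum_tmul, ha, TensorProduct.zero_tmul, zero_smul]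
  rw [← sub_zero (∑ i, (j i ⊗ₜ[k] (1 : A)) • v i), ← h₁, ← Finset.sum_sub_distrib]
  refine sum_mem fun i _ => ?_
  rw [← smul_sub]
  refine Submodule.smul_mem_smul (tmul_one_mem_jacobsonIdeal k A (hmem i)) ?_
  rw [LinearMap.mem_ker, map_sub, map_sum, sub_eq_zero, hb]
  simp [hw]

theorem MatrixUnitsModJacobson.exists_average (U : MatrixUnitsModJacobson k E)
    {X Y : Type*} [AddCommGroup X] [AddCommGroup Y] [Module (E ⊗[k] A) X] [Module (E ⊗[k] A) Y]
    (f : X →+ Y) (hf : ∀ (a : A) x, f (((1 : E) ⊗ₜ[k] a) • x) = ((1 : E) ⊗ₜ[k] a) • f x)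
    (hX : ∀ r ∈ Ring.jacobson E, ∀ x, f ((r ⊗ₜ[k] (1 : A)) • x) = 0)
    (hY : ∀ r ∈ Ring.jacobson E, ∀ x, (r ⊗ₜ[k] (1 : A)) • f x = 0) (i : Fin U.n) :
    ∃ g : X →ₗ[E ⊗[k] A] Y,
      ∀ x, g x = ∑ j, (U.u i j ⊗ₜ[k] (1 : A)) • f ((U.w i j ⊗ₜ[k] (1 : A)) • x) := by
  let : Module E X := Module.compHom X
    (Algebra.TensorProduct.includeLeftRingHom : E →+* E ⊗[k] A)
  let : Module E Y := Module.compHom Y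
    (Algebra.TensorProduct.includeLeftRingHom : E →+* E ⊗[k] A)
  let : Module k X := Module.compHom X (algebraMap k (E ⊗[k] A))
  let : Module k Y := Module.compHom Y (algebraMap k (E ⊗[k] A))
  have h₁ (c : k) : algebraMap k (E ⊗[k] A) c = (1 : E) ⊗ₜ[k] algebraMap k A c := by
    simp [Algebra.algebraMap_eq_smul_one, Algebra.TensorProduct.one_def]
  have h₂ (c : k) (e : E) :
      (c • e) ⊗ₜ[k] (1 : A) = algebraMap k (E ⊗[k] A) c * e ⊗ₜ[k] (1 : A) := by
    rw [← Algebra.smul_def, TensorProduct.smul_tmul']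
  have : IsScalarTower k E X := ⟨fun c e x => by
    change ((c • e) ⊗ₜ[k] (1 : A)) • x = algebraMap k (E ⊗[k] A) c • (e ⊗ₜ[k] (1 : A)) • x
    rw [h₂, mul_smul]⟩
  have : IsScalarTower k E Y := ⟨fun c e x => by
    change ((c • e) ⊗ₜ[k] (1 : A)) • x = algebraMap k (E ⊗[k] A) c • (e ⊗ₜ[k] (1 : A)) • x
    rw [h₂, mul_smul]⟩
  -- The field also acts through the factor A, so A-linearity of f already gives k-linearity.
  let f' : X →ₗ[k] Y :=
    { f with
      map_smul' c x := by
        change f (algebraMap k (E ⊗[k] A) c • x) = algebraMap k (E ⊗[k] A) c • f x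
        rw [h₁, hf] }
  have hE (e : E) (x : X) : U.average i f' ((e ⊗ₜ[k] (1 : A)) • x) =
      (e ⊗ₜ[k] (1 : A)) • U.average i f' x := U.average_smul f' hX hY i e x
  have hA (a : A) (x : X) : U.average i f' (((1 : E) ⊗ₜ[k] a) • x) =
      ((1 : E) ⊗ₜ[k] a) • U.average i f' x := by
    change ∑ j, (U.u i j ⊗ₜ[k] (1 : A)) • f ((U.w i j ⊗ₜ[k] (1 : A)) • ((1 : E) ⊗ₜ[k] a) • x) =
      ((1 : E) ⊗ₜ[k] a) • ∑ j, (U.u i j ⊗ₜ[k] (1 : A)) • f ((U.w i j ⊗ₜ[k] (1 : A)) • x)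
    rw [Finset.smul_sum]
    refine Finset.sum_congr rfl fun j _ => ?_
    have hc (e : E) : e ⊗ₜ[k] (1 : A) * (1 : E) ⊗ₜ[k] a = (1 : E) ⊗ₜ[k] a * e ⊗ₜ[k] (1 : A) := by
      simp
    rw [← mul_smul, hc, mul_smul, hf, ← mul_smul, hc, mul_smul]
  have hadd (x y : X) : U.average i f' (x + y) = U.average i f' x + U.average i f' y := by
    simp only [MatrixUnitsModJacobson.average, smul_add, map_add, Finset.sum_add_distrib]
  refine ⟨{ toFun := U.average i f', map_add' := hadd, map_smul' := fun t x => ?_ }, fun x => rfl⟩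
  rw [RingHom.id_apply]
  induction t with
  | zero => rw [zero_smul, zero_smul]; simpa using hadd 0 0
  | add t s ht hs => rw [add_smul, add_smul, hadd, ht, hs]
  | tmul e a =>
    have : e ⊗ₜ[k] a = e ⊗ₜ[k] (1 : A) * (1 : E) ⊗ₜ[k] a := by simp
    rw [this, mul_smul, hE, hA, mul_smul]

theorem tmul_one_smul_quotient_eq_zero {W : Type*} [AddCommGroup W] [Module (E ⊗[k] A) W] {r : E}
    (hr : r ∈ Ring.jacobson E)
    (y : W ⧸ (jacobsonIdeal k E A • ⊤ : Submodule (E ⊗[k] A) W)) : (r ⊗ₜ[k] (1 : A)) • y = 0 := by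
  obtain ⟨x, rfl⟩ := Submodule.Quotient.mk_surjective _ y
  rw [← Submodule.Quotient.mk_smul, Submodule.Quotient.mk_eq_zero]
  exact Submodule.smul_mem_smul (tmul_one_mem_jacobsonIdeal k A hr) trivial

/-- The map θ identifies B/JB with the projective A-module Q, so an A-linear section exists;
averaging over all blocks of matrix units makes it linear over E as well. -/
theorem exists_section_quotient_jacobsonIdeal [IsAlgClosed k] [Module.Finite k E]
    {B : Type*} [AddCommGroup B] [Module (E ⊗[k] A) B]
    {Q : Type*} [AddCommGroup Q] [Module A Q] [Module.Projective A Q] (θ : B →+ Q)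
    (hθ : Function.Surjective θ) (hθA : ∀ (a : A) b, θ (((1 : E) ⊗ₜ[k] a) • b) = a • θ b)
    (hθk : ∀ b, θ b = 0 ↔ b ∈ jacobsonIdeal k E A • (⊤ : Submodule (E ⊗[k] A) B))
    {V : Type*} [AddCommGroup V] [Module (E ⊗[k] A) V] (π : V →ₗ[E ⊗[k] A] B)
    (hπ : Function.Surjective π) :
    ∃ s : (B ⧸ (jacobsonIdeal k E A • ⊤ : Submodule (E ⊗[k] A) B)) →ₗ[E ⊗[k] A]
        (V ⧸ (jacobsonIdeal k E A • ⊤ : Submodule (E ⊗[k] A) V)),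
      ∀ y v, Submodule.Quotient.mk v = s y → Submodule.Quotient.mk (π v) = y := by
  obtain ⟨U⟩ := exists_matrixUnitsModJacobson k E
  set IV := (jacobsonIdeal k E A • ⊤ : Submodule (E ⊗[k] A) V) with hIV
  set IB := (jacobsonIdeal k E A • ⊤ : Submodule (E ⊗[k] A) B) with hIB
  have hle : IV ≤ IB.comap π := by
    rw [← Submodule.map_le_iff_le_comap, hIV, Submodule.map_smul'']
    exact Submodule.smul_mono le_rfl le_top
  let π' : (V ⧸ IV) →ₗ[E ⊗[k] A] (B ⧸ IB) := IV.mapQ IB π hle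
  let θ' : (B ⧸ IB) →+ Q := QuotientAddGroup.lift IB.toAddSubgroup θ fun b hb => (hθk b).2 hb
  have hθ' (b : B) : θ' (Submodule.Quotient.mk b) = θ b := rfl
  have hθ'inj : Function.Injective θ' := by
    rw [injective_iff_map_eq_zero]
    intro y hy
    obtain ⟨b, rfl⟩ := Submodule.Quotient.mk_surjective _ y
    exact (Submodule.Quotient.mk_eq_zero _).2 ((hθk b).1 hy)
  have hθ'A (a : A) (y : B ⧸ IB) : θ' (((1 : E) ⊗ₜ[k] a) • y) = a • θ' y := by
    obtain ⟨b, rfl⟩ := Submodule.Quotient.mk_surjective _ y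
    exact hθA a b
  let : Module A (V ⧸ IV) := Module.compHom (V ⧸ IV)
    (Algebra.TensorProduct.includeRight.toRingHom : A →+* E ⊗[k] A)
  let ψ : (V ⧸ IV) →ₗ[A] Q :=
    { toFun y := θ' (π' y)
      map_add' y z := by rw [map_add, map_add]
      map_smul' a y := by
        change θ' (π' (((1 : E) ⊗ₜ[k] a) • y)) = a • θ' (π' y)
        rw [map_smul, hθ'A] }
  have hψ : Function.Surjective ψ := fun q => by
    obtain ⟨b, rfl⟩ := hθ q
    obtain ⟨v, rfl⟩ := hπ b
    exact ⟨Submodule.Quotient.mk v, rfl⟩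
  obtain ⟨σ, hσ⟩ := Module.projective_lifting_property ψ LinearMap.id hψ
  let f : (B ⧸ IB) →+ (V ⧸ IV) := σ.toAddMonoidHom.comp θ'
  have hf (y : B ⧸ IB) : π' (f y) = y := hθ'inj congr($hσ (θ' y))
  choose g hg using U.exists_average f
    (fun a y => by
      change σ (θ' _) = ((1 : E) ⊗ₜ[k] a) • σ (θ' y)
      rw [hθ'A, map_smul]
      rfl)
    (fun r hr y => by rw [tmul_one_smul_quotient_eq_zero hr, map_zero])
    (fun r hr y => tmul_one_smul_quotient_eq_zero hr _)
  refine ⟨∑ i, g i, fun y v hv => ?_⟩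
  change π' (Submodule.Quotient.mk v) = y
  -- The sum of all u w is 1 modulo J, so averaging preserves the property of being a section.
  have hU := tmul_one_smul_quotient_eq_zero U.sum_u_mul_w y
  rw [TensorProduct.sub_tmul, sub_smul, ← Algebra.TensorProduct.one_def, one_smul, sub_eq_zero,
    TensorProduct.sum_tmul, Finset.sum_smul] at hU
  rw [hv, LinearMap.sum_apply, map_sum, ← hU]
  refine Finset.sum_congr rfl fun i _ => ?_
  rw [hU, hg, map_sum, TensorProduct.sum_tmul, Finset.sum_smul]
  refine Finset.sum_congr rfl fun j _ => ?_
  rw [map_smul, hf, ← mul_smul, Algebra.TensorProduct.tmul_mul_tmul, mul_one]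

end Bimodules

/-! ### A projectivity criterion for bimodules. -/

section Projective

open TensorProduct

variable {k : Type w} [Field k] {E : Type u₁} [Ring E] [Algebra k E] {A : Type u₁} [Ring A]
  [Algebra k A]

/-- A bimodule `B` which is flat over `E` and such that `B / JB` is projective over `A`, where `J`
is the Jacobson radical of `E`, is projective. -/
theorem projective_of_flat_of_quotient_projective [IsAlgClosed k] [Module.Finite k E]
    {B : Type u₁} [AddCommGroup B] [Module (E ⊗[k] A) B] {n : ℕ} {j : Fin n → E}
    (hj : Submodule.span k (Set.range j) = (Ring.jacobson E).restrictScalars k)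
    (hflat : ∀ b : Fin n → B, ∑ i, (j i ⊗ₜ[k] (1 : A)) • b i = 0 →
      ∃ (m : ℕ) (c : Fin m → B) (a : Fin n → Fin m → E),
        (∀ i, b i = ∑ l, (a i l ⊗ₜ[k] (1 : A)) • c l) ∧ ∀ l, ∑ i, j i * a i l = 0)
    {Q : Type*} [AddCommGroup Q] [Module A Q] [Module.Projective A Q] (θ : B →+ Q)
    (hθ : Function.Surjective θ) (hθA : ∀ (a : A) b, θ (((1 : E) ⊗ₜ[k] a) • b) = a • θ b)
    (hθk : ∀ b, θ b = 0 ↔ b ∈ jacobsonIdeal k E A • (⊤ : Submodule (E ⊗[k] A) B)) :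
    Module.Projective (E ⊗[k] A) B := by
  obtain ⟨N, hN⟩ := exists_jacobsonIdeal_pow_eq_bot k (E := E) A
  obtain ⟨s, hs⟩ := exists_section_of_pow_smul_ker_eq_bot (jacobsonIdeal k E A)
    (fun V _ _ π hπ => ker_inf_jacobsonIdeal_smul_top_le hj hflat π hπ)
    (fun V _ _ π hπ => exists_section_quotient_jacobsonIdeal θ hθ hθA hθk π hπ) N
    (B →₀ E ⊗[k] A) (Finsupp.linearCombination (E ⊗[k] A) id)
    (Finsupp.linearCombination_id_surjective _ _) (by rw [hN, Submodule.bot_smul])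
  exact ⟨s, fun b => congr($hs b)⟩

end Projective

/-! ### The bimodule of an endofunctor. -/

section EvalAt

open TensorProduct

variable {M : Type u₂} [Category.{v₂} M]

/-- The group `Hom(p, F(p))`, viewed as a bimodule: endomorphisms of `p` act through `F` by
postcomposition and by precomposition. -/
def EvalAt (p : M) (F : M ⥤ M) : Type v₂ := p ⟶ F.obj p

namespace EvalAt

variable {p : M} {F G : M ⥤ M}

/-- A morphism `p ⟶ F(p)`, as an element of `EvalAt p F`. -/
def mk (v : p ⟶ F.obj p) : EvalAt p F := v

/-- The morphism `p ⟶ F(p)` underlying an element of `EvalAt p F`. -/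
def hom (v : EvalAt p F) : p ⟶ F.obj p := v

@[ext] theorem ext {v v' : EvalAt p F} (h : v.hom = v'.hom) : v = v' := h

@[simp] theorem hom_mk (v : p ⟶ F.obj p) : (mk v : EvalAt p F).hom = v := rfl

variable [Preadditive M]

instance : AddCommGroup (EvalAt p F) := inferInstanceAs (AddCommGroup (p ⟶ F.obj p))

instance : Module (End p)ᵐᵒᵖ (EvalAt p F) := inferInstanceAs (Module (End p)ᵐᵒᵖ (p ⟶ F.obj p))

instance {k : Type w} [Field k] [Linear k M] : Module k (EvalAt p F) :=
  inferInstanceAs (Module k (p ⟶ F.obj p))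

/-- Multiplication in `End p` is e * e' = e' ≫ e, so postcomposition is a left action and
precomposition is one of the opposite ring. -/
instance [F.Additive] : Module (End p) (EvalAt p F) where
  smul e v := (show p ⟶ F.obj p from v) ≫ F.map e
  one_smul v := by
    change (show p ⟶ F.obj p from v) ≫ F.map (𝟙 p) = v
    rw [F.map_id, Category.comp_id]
  mul_smul e e' v := by
    change (show p ⟶ F.obj p from v) ≫ F.map (e' ≫ e) =
      ((show p ⟶ F.obj p from v) ≫ F.map e') ≫ F.map e
    rw [F.map_comp, Category.assoc]
  smul_zero e := zero_comp
  smul_add e v v' := Preadditive.add_comp _ _ _ _ _ _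
  add_smul e e' v := by
    change (show p ⟶ F.obj p from v) ≫ F.map ((e : p ⟶ p) + e') = _
    rw [F.map_add, Preadditive.comp_add]
    rfl
  zero_smul v := by
    change (show p ⟶ F.obj p from v) ≫ F.map (0 : p ⟶ p) = _
    rw [F.map_zero, comp_zero]
    rfl

@[simp] theorem hom_zero : (0 : EvalAt p F).hom = 0 := rfl

@[simp] theorem hom_add (v v' : EvalAt p F) : (v + v').hom = v.hom + v'.hom := rfl

theorem hom_sum {ι : Type*} (s : Finset ι) (v : ι → EvalAt p F) :
    (∑ i ∈ s, v i).hom = ∑ i ∈ s, (v i).hom := rfl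

@[simp] theorem hom_smul [F.Additive] (e : End p) (v : EvalAt p F) :
    (e • v).hom = v.hom ≫ F.map e := rfl

@[simp] theorem hom_op_smul (e : (End p)ᵐᵒᵖ) (v : EvalAt p F) :
    (e • v).hom = MulOpposite.unop e ≫ v.hom := rfl

section

variable {k : Type w} [Field k] [Linear k M]

@[simp] theorem hom_field_smul (c : k) (v : EvalAt p F) : (c • v).hom = c • v.hom := rfl

instance [F.Additive] : SMulCommClass (End p) (End p)ᵐᵒᵖ (EvalAt p F) where
  smul_comm e e' v := by ext; simp

instance : IsScalarTower k (End p)ᵐᵒᵖ (EvalAt p F) where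
  smul_assoc c e v := by
    ext
    simp

instance [F.Additive] [F.Linear k] : IsScalarTower k (End p) (EvalAt p F) where
  smul_assoc c e v := by
    ext
    change v.hom ≫ F.map (c • (show p ⟶ p from e)) = c • (v.hom ≫ F.map e)
    rw [F.map_smul, Linear.comp_smul]

variable [F.Additive] [F.Linear k] [G.Additive] [G.Linear k]

instance : Module (End p ⊗[k] (End p)ᵐᵒᵖ) (EvalAt p F) := TensorProduct.Algebra.module

theorem hom_tmul_smul (e : End p) (a : (End p)ᵐᵒᵖ) (v : EvalAt p F) :
    ((e ⊗ₜ[k] a) • v).hom = a.unop ≫ v.hom ≫ F.map e := by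
  refine (congr_arg EvalAt.hom (TensorProduct.Algebra.smul_def e a v)).trans ?_
  rw [hom_smul, hom_op_smul, Category.assoc]

variable (k) in
/-- The map of bimodules induced by a natural transformation. -/
def map (α : F ⟶ G) : EvalAt p F →ₗ[End p ⊗[k] (End p)ᵐᵒᵖ] EvalAt p G where
  toFun v := mk (v.hom ≫ α.app p)
  map_add' v v' := by ext; simp
  map_smul' t v := by
    rw [RingHom.id_apply]
    induction t with
    | zero =>
      refine (congr_arg (fun v => mk (EvalAt.hom v ≫ α.app p))
        (zero_smul (End p ⊗[k] (End p)ᵐᵒᵖ) v)).trans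
        (Eq.trans ?_ (zero_smul (End p ⊗[k] (End p)ᵐᵒᵖ) (mk (v.hom ≫ α.app p) : EvalAt p G)).symm)
      ext
      simp
    | add t s ht hs =>
      rw [add_smul, add_smul, ← ht, ← hs]
      ext
      simp
    | tmul e a =>
      ext
      rw [hom_tmul_smul, hom_mk, hom_tmul_smul, hom_mk]
      simp

theorem hom_map_mk_precomp (φ : EvalAt p F →ₗ[End p ⊗[k] (End p)ᵐᵒᵖ] EvalAt p G) (e : End p)
    (x : p ⟶ F.obj p) : (φ (mk ((show p ⟶ p from e) ≫ x))).hom = e ≫ (φ (mk x)).hom := by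
  have h (H : M ⥤ M) [H.Additive] [H.Linear k] (v : EvalAt p H) :
      (((1 : End p) ⊗ₜ[k] MulOpposite.op e) • v).hom = e ≫ v.hom := by
    rw [hom_tmul_smul]
    change e ≫ v.hom ≫ H.map (𝟙 p) = e ≫ v.hom
    rw [H.map_id, Category.comp_id]
  rw [← h, ← φ.map_smul]
  exact congr_arg (fun v => (φ v).hom) (ext (h F (mk x)).symm)

theorem hom_map_mk_postcomp (φ : EvalAt p F →ₗ[End p ⊗[k] (End p)ᵐᵒᵖ] EvalAt p G) (e : End p)
    (x : p ⟶ F.obj p) : (φ (mk (x ≫ F.map e))).hom = (φ (mk x)).hom ≫ G.map e := by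
  have h (H : M ⥤ M) [H.Additive] [H.Linear k] (v : EvalAt p H) :
      ((e ⊗ₜ[k] (1 : (End p)ᵐᵒᵖ)) • v).hom = v.hom ≫ H.map e := by
    rw [hom_tmul_smul]
    exact Category.id_comp _
  rw [← h, ← φ.map_smul]
  exact congr_arg (fun v => (φ v).hom) (ext (h F (mk x)).symm)

@[simp] theorem hom_map (α : F ⟶ G) (v : EvalAt p F) : (map k α v).hom = v.hom ≫ α.app p := rfl

end

end EvalAt

end EvalAt

/-! ### Full faithfulness of the passage to bimodules. -/

section FullyFaithful

open TensorProduct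

variable {M : Type u₂} [Category.{v₂} M] [Abelian M] {p : M}

theorem IsFiniteProgenerator.exists_hom (hp : IsFiniteProgenerator p) {X Y : M}
    (θ : (p ⟶ X) →+ (p ⟶ Y))
    (hθ : ∀ (e : p ⟶ p) (x : p ⟶ X), θ (e ≫ x) = e ≫ θ x) :
    ∃ f : X ⟶ Y, ∀ x : p ⟶ X, x ≫ f = θ x := by
  have := hp.projective
  obtain ⟨n, π, _⟩ := hp.exists_epi X
  let g : (⨁ fun _ : Fin n => p) ⟶ Y :=
    biproduct.desc fun i => θ (biproduct.ι (fun _ : Fin n => p) i ≫ π)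
  have hg (x : p ⟶ ⨁ fun _ : Fin n => p) : x ≫ g = θ (x ≫ π) := by
    conv_rhs => rw [← Category.id_comp π, ← biproduct.total, Preadditive.sum_comp,
      Preadditive.comp_sum, map_sum]
    simp only [g, biproduct.desc_eq, Preadditive.comp_sum]
    refine Finset.sum_congr rfl fun i _ => ?_
    rw [← Category.assoc, ← hθ, Category.assoc, Category.assoc]
  have hk : kernel.ι π ≫ g = 0 := hp.hom_eq_zero _ fun y => by
    rw [← Category.assoc, hg, Category.assoc, kernel.condition, comp_zero, map_zero]
  refine ⟨Abelian.epiDesc π g hk, fun x => ?_⟩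
  rw [← Projective.factorThru_comp x π, Category.assoc, Abelian.comp_epiDesc, hg]

/-- On a power of p the component is forced by additivity; right exactness of F lets it descend
along a cover of X by such a power. -/
theorem IsFiniteProgenerator.exists_natTrans (hp : IsFiniteProgenerator p) {D : Type u₁}
    [Category.{v₁} D] [Preadditive D] {F G : M ⥤ D} [F.Additive] [G.Additive]
    [PreservesFiniteColimits F]
    (φ : F.obj p ⟶ G.obj p)
    (hφ : ∀ e : p ⟶ p, F.map e ≫ φ = φ ≫ G.map e) : ∃ α : F ⟶ G, α.app p = φ := by
  have := hp.projective
  have key (X : M) : ∃ f : F.obj X ⟶ G.obj X, ∀ x : p ⟶ X, F.map x ≫ f = φ ≫ G.map x := by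
    obtain ⟨n, π, _⟩ := hp.exists_epi X
    let u : F.obj (⨁ fun _ : Fin n => p) ⟶ G.obj X :=
      ∑ i, F.map (biproduct.π _ i) ≫ φ ≫ G.map (biproduct.ι (fun _ : Fin n => p) i ≫ π)
    have hu (x : p ⟶ ⨁ fun _ : Fin n => p) : F.map x ≫ u = φ ≫ G.map (x ≫ π) := by
      conv_rhs => rw [← Category.id_comp π, ← biproduct.total, Preadditive.sum_comp,
        Preadditive.comp_sum, G.map_sum, Preadditive.comp_sum]
      simp only [u, Preadditive.comp_sum]
      refine Finset.sum_congr rfl fun i _ => ?_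
      have := hφ (x ≫ biproduct.π _ i)
      rw [← Category.assoc, ← Category.assoc, ← F.map_comp, this, Category.assoc, ← G.map_comp]
      simp only [Category.assoc]
    have hk : F.map (kernel.ι π) ≫ u = 0 := hp.map_hom_eq_zero F _ fun y => by
      rw [← Category.assoc, ← F.map_comp, hu, Category.assoc, kernel.condition, comp_zero,
        G.map_zero, comp_zero]
    obtain ⟨v, hv⟩ := F.exists_map_cokernel_π_comp_eq (kernel.ι π) u hk
    -- The comparison of X with the cokernel of the kernel of its cover.
    let d : X ⟶ cokernel (kernel.ι π) := Abelian.epiDesc π (cokernel.π _) (cokernel.condition _)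
    refine ⟨F.map d ≫ v, fun x => ?_⟩
    rw [← Projective.factorThru_comp x π, F.map_comp, Category.assoc, ← Category.assoc (F.map π),
      ← F.map_comp, Abelian.comp_epiDesc, hv, hu]
  choose f hf using key
  refine ⟨{ app := f, naturality := fun X Y g => ?_ }, ?_⟩
  · rw [← sub_eq_zero]
    refine hp.map_hom_eq_zero F _ fun x => ?_
    rw [Preadditive.comp_sub, ← Category.assoc, ← F.map_comp, hf, ← Category.assoc, hf,
      G.map_comp, Category.assoc, sub_self]
  · have := hf p (𝟙 p)
    rwa [F.map_id, Category.id_comp, G.map_id, Category.comp_id] at this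

variable {k : Type w} [Field k] [Linear k M] {F G : M ⥤ M} [F.Additive] [F.Linear k] [G.Additive]
  [G.Linear k] [PreservesFiniteColimits F]

/-- Linearity for precomposition yields a morphism F(p) ⟶ G(p), and linearity for postcomposition
makes it commute with `End p`, so it extends to all objects. -/
theorem EvalAt.map_surjective (hp : IsFiniteProgenerator p)
    (φ : EvalAt p F →ₗ[End p ⊗[k] (End p)ᵐᵒᵖ] EvalAt p G) :
    ∃ α : F ⟶ G, EvalAt.map k α = φ := by
  obtain ⟨f, hf⟩ := hp.exists_hom (X := F.obj p) (Y := G.obj p)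
    { toFun x := (φ (EvalAt.mk x)).hom
      map_zero' := congr_arg EvalAt.hom (map_zero φ)
      map_add' x y := congr_arg EvalAt.hom (map_add φ (EvalAt.mk x) (EvalAt.mk y)) }
    (fun e x => EvalAt.hom_map_mk_precomp φ e x)
  obtain ⟨α, hα⟩ := hp.exists_natTrans (F := F) (G := G) f (fun e => by
    rw [← sub_eq_zero]
    refine hp.hom_eq_zero _ fun x => ?_
    rw [Preadditive.comp_sub, ← Category.assoc, hf, ← Category.assoc, hf, sub_eq_zero]
    exact EvalAt.hom_map_mk_postcomp φ e x)
  refine ⟨α, LinearMap.ext fun v => EvalAt.ext ?_⟩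
  rw [EvalAt.hom_map, hα]
  exact hf v

theorem EvalAt.map_injective (hp : IsFiniteProgenerator p) {α β : F ⟶ G}
    (h : EvalAt.map (p := p) k α = EvalAt.map k β) : α = β := by
  have hp' : α.app p = β.app p := by
    rw [← sub_eq_zero]
    refine hp.hom_eq_zero _ fun x => ?_
    rw [Preadditive.comp_sub, sub_eq_zero]
    exact congr(($h (EvalAt.mk x)).hom)
  ext X
  rw [← sub_eq_zero]
  refine hp.map_hom_eq_zero F _ fun x => ?_
  rw [Preadditive.comp_sub, sub_eq_zero, α.naturality, β.naturality, hp']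

end FullyFaithful

/-! ### Exact functors with projective values give projective bimodules. -/

section ProjectiveEvalAt

open TensorProduct

/-- The morphism c detects the cokernel of g, so b lands in the image of g, and p is projective. -/
theorem CategoryTheory.exists_comp_eq_of_forall_exists {C : Type u₁} [Category.{v₁} C] [Abelian C]
    {p X Y Z : C} [Projective p] (g : X ⟶ Y) (c : Y ⟶ Z)
    (hc : ∀ {W : C} (u : Y ⟶ W), g ≫ u = 0 → ∃ v, c ≫ v = u) (b : p ⟶ Y) (hb : b ≫ c = 0) :
    ∃ b' : p ⟶ X, b' ≫ g = b := by
  obtain ⟨v, hv⟩ := hc (cokernel.π g) (cokernel.condition g)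
  have hb' : b ≫ cokernel.π g = 0 := by rw [← hv, ← Category.assoc, hb, zero_comp]
  obtain ⟨b', h⟩ : ∃ b' : p ⟶ X, b' ≫ Abelian.factorThruImage g = kernel.lift _ b hb' :=
    ⟨_, Projective.factorThru_comp _ _⟩
  refine ⟨b', ?_⟩
  rw [← Abelian.image.fac g, ← Category.assoc, h]
  exact kernel.lift_ι _ _ _

variable {M : Type u₂} [Category.{v₂} M] [Abelian M] {p : M}

theorem IsFiniteProgenerator.projective_hom (hp : IsFiniteProgenerator p) (Q : M) [Projective Q] :
    Module.Projective (End p)ᵐᵒᵖ (p ⟶ Q) := by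
  obtain ⟨n, f, _⟩ := hp.exists_epi Q
  let s : Q ⟶ ⨁ fun _ : Fin n => p := Projective.factorThru (𝟙 Q) f
  have hs : s ≫ f = 𝟙 Q := Projective.factorThru_comp _ _
  let i : (p ⟶ Q) →ₗ[(End p)ᵐᵒᵖ] (Fin n → (End p)ᵐᵒᵖ) :=
    { toFun x j := MulOpposite.op (x ≫ s ≫ biproduct.π _ j)
      map_add' x y := by
        ext j
        simp [Preadditive.add_comp]
      map_smul' e x := by
        ext j
        exact congr_arg MulOpposite.op (Category.assoc (show p ⟶ p from e.unop) x _) }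
  let r : (Fin n → (End p)ᵐᵒᵖ) →ₗ[(End p)ᵐᵒᵖ] (p ⟶ Q) :=
    { toFun e := ∑ j, (show p ⟶ p from (e j).unop) ≫ biproduct.ι (fun _ : Fin n => p) j ≫ f
      map_add' e e' := by
        rw [← Finset.sum_add_distrib]
        exact Finset.sum_congr rfl fun j _ => Preadditive.add_comp _ _ _ _ _ _
      map_smul' a e := by
        rw [RingHom.id_apply, Finset.smul_sum]
        exact Finset.sum_congr rfl fun j _ => Category.assoc _ _ _ }
  refine Module.Projective.of_split i r (LinearMap.ext fun x => ?_)
  change ∑ j, (x ≫ s ≫ biproduct.π _ j) ≫ biproduct.ι (fun _ : Fin n => p) j ≫ f = x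
  calc _ = x ≫ s ≫ (∑ j, biproduct.π _ j ≫ biproduct.ι (fun _ : Fin n => p) j) ≫ f := by
        simp only [Preadditive.comp_sum, Preadditive.sum_comp, Category.assoc]
    _ = x := by rw [biproduct.total, Category.id_comp, hs, Category.comp_id]

variable {k : Type w} [Field k] [IsAlgClosed k] [Linear k M]

/-- Encode a spanning family of J as d : pⁿ ⟶ p. A relation ∑ j_i b_i = 0 is a map p ⟶ G(pⁿ) killed
by G(d), and left exactness of G trivialises it through ker d. Right exactness identifies B/JB with
Hom(p, G(coker d)), which is projective because G(coker d) is. -/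
theorem EvalAt.projective (hp : IsFiniteProgenerator p) [Module.Finite k (End p)] (G : M ⥤ M)
    [G.Additive] [G.Linear k] [PreservesFiniteColimits G] [PreservesFiniteLimits G]
    (hG : ∀ X, Projective (G.obj X)) :
    Module.Projective (End p ⊗[k] (End p)ᵐᵒᵖ) (EvalAt p G) := by
  have := hp.projective
  obtain ⟨n, j', hj'⟩ := Module.Finite.exists_fin (R := k)
    (M := (Ring.jacobson (End p)).restrictScalars k)
  let j (i : Fin n) : End p := (j' i).1
  have hj : Submodule.span k (Set.range j) = (Ring.jacobson (End p)).restrictScalars k := by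
    have := congr_arg (Submodule.map (Submodule.subtype _)) hj'
    rwa [Submodule.map_span, Submodule.map_subtype_top, ← Set.range_comp] at this
  let d : (⨁ fun _ : Fin n => p) ⟶ p := biproduct.desc j
  have hd (i : Fin n) : biproduct.ι (fun _ : Fin n => p) i ≫ d = j i := biproduct.ι_desc _ _
  have hsum {n : ℕ} {Y : M} (b : Y ⟶ G.obj (⨁ fun _ : Fin n => p)) {Z : M}
      (f : (⨁ fun _ : Fin n => p) ⟶ Z) : b ≫ G.map f = ∑ i, (b ≫ G.map (biproduct.π _ i)) ≫
        G.map (biproduct.ι (fun _ : Fin n => p) i ≫ f) := by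
    conv_lhs => rw [← Category.id_comp f, ← biproduct.total, Preadditive.sum_comp, G.map_sum,
      Preadditive.comp_sum]
    simp only [G.map_comp, Category.assoc]
  have hsmul (e : End p) (v : EvalAt p G) : (e ⊗ₜ[k] (1 : (End p)ᵐᵒᵖ)) • v = e • v := by
    ext
    rw [EvalAt.hom_tmul_smul]
    exact Category.id_comp _
  have := hG (cokernel d)
  have := hp.projective_hom (G.obj (cokernel d))
  let θ : EvalAt p G →+ (p ⟶ G.obj (cokernel d)) :=
    { toFun v := v.hom ≫ G.map (cokernel.π d)
      map_zero' := zero_comp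
      map_add' x y := Preadditive.add_comp _ _ _ _ _ _ }
  refine projective_of_flat_of_quotient_projective hj (fun b hb => ?_) θ (fun q => ?_)
    (fun a b => ?_) (fun b => ⟨fun hb => ?_, fun hb => ?_⟩)
  · let β : p ⟶ G.obj (⨁ fun _ : Fin n => p) :=
      ∑ i, (b i).hom ≫ G.map (biproduct.ι (fun _ : Fin n => p) i)
    have hβ (i : Fin n) : β ≫ G.map (biproduct.π _ i) = (b i).hom := by
      simp only [β, Preadditive.sum_comp, Category.assoc, ← G.map_comp]
      rw [Finset.sum_eq_single i]
      · rw [biproduct.ι_π_self, G.map_id, Category.comp_id]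
      · intro l _ hl
        rw [biproduct.ι_π_ne _ hl, G.map_zero, comp_zero]
      · simp
    have hβd : β ≫ G.map d = 0 := by
      rw [hsum]
      simp only [hβ, hd]
      simp only [hsmul] at hb
      exact congr_arg EvalAt.hom hb
    obtain ⟨γ, hγ⟩ : ∃ γ : p ⟶ G.obj (kernel d), γ ≫ G.map (kernel.ι d) = β :=
      ⟨(isLimitOfHasKernelOfPreservesLimit G d).lift (KernelFork.ofι β hβd),
        (isLimitOfHasKernelOfPreservesLimit G d).fac (KernelFork.ofι β hβd)
          WalkingParallelPair.zero⟩
    -- Lifting γ to G(pᵐ) gives the elements c_l, and the matrix of pᵐ ⟶ ker d ⟶ pⁿ gives the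
    -- coefficients a_il.
    obtain ⟨m, q, _⟩ := hp.exists_epi (kernel d)
    let γ' : p ⟶ G.obj (⨁ fun _ : Fin m => p) := Projective.factorThru γ (G.map q)
    have hγ' : γ' ≫ G.map q = γ := Projective.factorThru_comp _ _
    refine ⟨m, fun l => EvalAt.mk (γ' ≫ G.map (biproduct.π _ l)), fun i l =>
      (biproduct.ι (fun _ : Fin m => p) l ≫ q ≫ kernel.ι d ≫ biproduct.π _ i : p ⟶ p),
      fun i => ?_, fun l => ?_⟩
    · simp only [hsmul]
      refine EvalAt.ext ((hβ i).symm.trans ?_)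
      rw [EvalAt.hom_sum, ← hγ, ← hγ', Category.assoc, Category.assoc, ← G.map_comp, ← G.map_comp,
        hsum]
      rfl
    · change ∑ i, (biproduct.ι (fun _ : Fin m => p) l ≫ q ≫ kernel.ι d ≫ biproduct.π _ i) ≫ j i = 0
      calc _ = biproduct.ι (fun _ : Fin m => p) l ≫ q ≫ kernel.ι d ≫
            ∑ i, biproduct.π (fun _ : Fin n => p) i ≫ j i := by
            simp only [Preadditive.comp_sum, Category.assoc]
        _ = 0 := by
            rw [← biproduct.desc_eq, kernel.condition, comp_zero, comp_zero]
  · exact ⟨EvalAt.mk (Projective.factorThru q (G.map (cokernel.π d))),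
      Projective.factorThru_comp _ _⟩
  · change (((1 : End p) ⊗ₜ[k] a) • b).hom ≫ _ = a.unop ≫ b.hom ≫ _
    rw [EvalAt.hom_tmul_smul]
    change (a.unop ≫ b.hom ≫ G.map (𝟙 p)) ≫ _ = _
    rw [G.map_id, Category.comp_id, Category.assoc]
  · obtain ⟨b', hb'⟩ := exists_comp_eq_of_forall_exists (G.map d) (G.map (cokernel.π d))
      (fun u hu => G.exists_map_cokernel_π_comp_eq d u hu) b.hom hb
    have : b = ∑ i, (j i ⊗ₜ[k] (1 : (End p)ᵐᵒᵖ)) •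
        (EvalAt.mk (b' ≫ G.map (biproduct.π _ i)) : EvalAt p G) := by
      simp only [hsmul]
      refine EvalAt.ext (hb'.symm.trans ?_)
      rw [EvalAt.hom_sum, hsum]
      simp only [hd]
      rfl
    rw [this]
    exact sum_mem fun i _ => Submodule.smul_mem_smul
      (tmul_one_mem_jacobsonIdeal k _ (j' i).2) trivial
  · obtain ⟨v, rfl⟩ := exists_eq_sum_of_mem_jacobsonIdeal_smul_top hj hb
    rw [map_sum]
    refine Finset.sum_eq_zero fun i _ => ?_
    rw [hsmul]
    change ((v i).hom ≫ G.map (j i)) ≫ G.map (cokernel.π d) = 0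
    rw [Category.assoc, ← G.map_comp, ← hd, Category.assoc, cokernel.condition, comp_zero,
      G.map_zero, comp_zero]

end ProjectiveEvalAt

/-! ### Adjunctions between actions of dual objects. -/

section ActionAdjunction

open MonoidalLeftAction

variable {C : Type u₁} [Category.{v₁} C] [MonoidalCategory C]
  {M : Type u₂} [Category.{v₂} M] [MonoidalLeftAction C M]

theorem associator_inv_actionHomLeft (X Y Z : C) (m : M) :
    (α_ X Y Z).inv ⊵ₗ m = (αₗ X (Y ⊗ Z) m).hom ≫ X ⊴ₗ (αₗ Y Z m).hom ≫
      (αₗ X Y (Z ⊙ₗ m)).inv ≫ (αₗ (X ⊗ Y) Z m).inv := by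
  rw [← cancel_epi ((α_ X Y Z).hom ⊵ₗ m), associator_actionHom_assoc]
  simp

theorem leftUnitor_inv_actionHomLeft (X : C) (m : M) :
    (λ_ X).inv ⊵ₗ m = (λₗ[C] (X ⊙ₗ m)).inv ≫ (αₗ (𝟙_ C) X m).inv := by
  rw [← cancel_epi ((λ_ X).hom ⊵ₗ m), hom_inv_actionHomLeft]
  simp

theorem rightUnitor_inv_actionHomLeft (X : C) (m : M) :
    (ρ_ X).inv ⊵ₗ m = X ⊴ₗ (λₗ[C] m).inv ≫ (αₗ X (𝟙_ C) m).inv := by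
  rw [← cancel_epi ((ρ_ X).hom ⊵ₗ m), hom_inv_actionHomLeft]
  simp

/-- Up to coherence, this is the zigzag identity of the duality acting on m. -/
theorem actionHomRight_unit_comp_counit (Y X : C) [ExactPairing Y X] (m : M) :
    X ⊴ₗ ((λₗ[C] m).inv ≫ (η_ Y X) ⊵ₗ m ≫ (αₗ Y X m).hom) ≫
      (αₗ X Y (X ⊙ₗ m)).inv ≫ (ε_ Y X) ⊵ₗ (X ⊙ₗ m) ≫ (λₗ[C] (X ⊙ₗ m)).hom = 𝟙 (X ⊙ₗ m) := by
  refine Eq.trans (b := (ρ_ X).inv ⊵ₗ m ≫ (X ◁ η_ Y X ≫ (α_ X Y X).inv ≫ ε_ Y X ▷ X) ⊵ₗ m ≫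
    (λ_ X).hom ⊵ₗ m) ?_ ?_
  · rw [comp_actionHomLeft, comp_actionHomLeft, associator_inv_actionHomLeft,
      rightUnitor_inv_actionHomLeft]
    simp
  · rw [ExactPairing.coevaluation_evaluation, ← comp_actionHomLeft, ← comp_actionHomLeft,
      ← id_actionHomLeft]
    simp only [Category.assoc, Iso.inv_hom_id, Category.comp_id]

theorem unit_comp_actionHomRight_counit (Y X : C) [ExactPairing Y X] (m : M) :
    ((λₗ[C] (Y ⊙ₗ m)).inv ≫ (η_ Y X) ⊵ₗ (Y ⊙ₗ m) ≫ (αₗ Y X (Y ⊙ₗ m)).hom) ≫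
      Y ⊴ₗ ((αₗ X Y m).inv ≫ (ε_ Y X) ⊵ₗ m ≫ (λₗ[C] m).hom) = 𝟙 (Y ⊙ₗ m) := by
  refine Eq.trans (b := (λ_ Y).inv ⊵ₗ m ≫ (η_ Y X ▷ Y ≫ (α_ Y X Y).hom ≫ Y ◁ ε_ Y X) ⊵ₗ m ≫
    (ρ_ Y).hom ⊵ₗ m) ?_ ?_
  · rw [comp_actionHomLeft, comp_actionHomLeft, leftUnitor_inv_actionHomLeft]
    simp only [Category.assoc, actionHomLeft_action, actionHomRight_comp, rightUnitor_actionHom]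
    rw [← associator_actionHom_assoc]
    simp
  · rw [ExactPairing.evaluation_coevaluation, ← comp_actionHomLeft, ← comp_actionHomLeft,
      ← id_actionHomLeft]
    simp only [Category.assoc, Iso.inv_hom_id, Category.comp_id]

variable (M) in
/-- The adjunction `X ⊙ - ⊣ Y ⊙ -` coming from a duality between `Y` and `X`. -/
def actionLeftAdjunction (Y X : C) [ExactPairing Y X] : actionLeft M X ⊣ actionLeft M Y where
  unit :=
    { app m := (λₗ[C] m).inv ≫ (η_ Y X) ⊵ₗ m ≫ (αₗ Y X m).hom
      naturality m n f := by
        change f ≫ (λₗ[C] n).inv ≫ η_ Y X ⊵ₗ n ≫ (αₗ Y X n).hom =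
          ((λₗ[C] m).inv ≫ η_ Y X ⊵ₗ m ≫ (αₗ Y X m).hom) ≫ Y ⊴ₗ X ⊴ₗ f
        have h : (αₗ Y X m).hom ≫ Y ⊴ₗ X ⊴ₗ f = (Y ⊗ X) ⊴ₗ f ≫ (αₗ Y X n).hom := by simp
        rw [Category.assoc, Category.assoc, h, ← action_exchange_assoc,
          actionUnitIso_inv_naturality_assoc] }
  counit :=
    { app m := (αₗ X Y m).inv ≫ (ε_ Y X) ⊵ₗ m ≫ (λₗ[C] m).hom
      naturality m n f := by
        change X ⊴ₗ Y ⊴ₗ f ≫ (αₗ X Y n).inv ≫ ε_ Y X ⊵ₗ n ≫ (λₗ[C] n).hom =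
          ((αₗ X Y m).inv ≫ ε_ Y X ⊵ₗ m ≫ (λₗ[C] m).hom) ≫ f
        have h : X ⊴ₗ Y ⊴ₗ f ≫ (αₗ X Y n).inv = (αₗ X Y m).inv ≫ (X ⊗ Y) ⊴ₗ f := by simp
        rw [reassoc_of% h, Category.assoc, Category.assoc, actionUnitIso_hom_naturality,
          action_exchange_assoc] }
  left_triangle_components m := actionHomRight_unit_comp_counit Y X m
  right_triangle_components m := unit_comp_actionHomRight_counit Y X m

end ActionAdjunction

/-! ### Exactness and injectivity from duality. -/

section DualAction

open MonoidalLeftAction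

theorem projective_biproduct {C : Type u₁} [Category.{v₁} C] [Abelian C] {ι : Type*} [Finite ι]
    (p : ι → C) [∀ i, Projective (p i)] : Projective (⨁ p) where
  factors f e _ := ⟨biproduct.desc fun i => Projective.factorThru (biproduct.ι p i ≫ f) e,
    biproduct.hom_ext' _ _ fun i => by
      rw [biproduct.ι_desc_assoc, Projective.factorThru_comp]⟩

theorem IsFiniteProgenerator.enoughProjectives {C : Type u₁} [Category.{v₁} C] [Abelian C] {p : C}
    (hp : IsFiniteProgenerator p) : EnoughProjectives C where
  presentation X := by
    have := hp.projective
    obtain ⟨n, f, _⟩ := hp.exists_epi X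
    have := projective_biproduct fun _ : Fin n => p
    exact ⟨{ p := ⨁ fun _ : Fin n => p, f := f }⟩

theorem IsFiniteTensorCategory.monoidalPreadditive (k : Type w) [Field k] (C : Type u₁)
    [Category.{v₁} C] [Preadditive C] [Linear k C] [MonoidalCategory C] [RigidCategory C]
    [h : IsFiniteTensorCategory k C] : MonoidalPreadditive C where
  whiskerLeft_zero {X Y Z} := by
    simpa using h.whiskerLeft_smul X (0 : k) (0 : Y ⟶ Z)
  zero_whiskerRight {X Y Z} := by
    simpa using h.smul_whiskerRight (0 : k) (0 : Y ⟶ Z) X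
  whiskerLeft_add := h.whiskerLeft_add _
  add_whiskerRight f g := h.add_whiskerRight f g _

/-- In a finite tensor category the evaluation morphism of a progenerator is an epimorphism. -/
theorem IsFiniteProgenerator.epi_evaluation {C : Type u₁} [Category.{v₁} C] [Abelian C]
    [MonoidalCategory C] {p q : C} (hp : IsFiniteProgenerator p)
    [MonoidalPreadditive C] [Simple (𝟙_ C)] [ExactPairing q p] : Epi (ε_ q p) := by
  refine epi_of_nonzero_to_simple fun h => id_nonzero (𝟙_ C) (hp.hom_eq_zero _ fun x => ?_)
  -- A vanishing evaluation would make p zero by the zigzag identity, and then the unit object as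
  -- well.
  have hp₀ : 𝟙 p = 0 := by
    have h' := ExactPairing.coevaluation_evaluation q p
    rw [h, MonoidalPreadditive.zero_whiskerRight, comp_zero, comp_zero] at h'
    rw [← cancel_mono (λ_ p).inv, ← cancel_epi (ρ_ p).hom, Category.id_comp, ← h', zero_comp,
      comp_zero]
  rw [← Category.id_comp x, hp₀, zero_comp, zero_comp]

variable {C : Type u₁} [Category.{v₁} C] [MonoidalCategory C]
  {M : Type u₂} [Category.{v₂} M] [MonoidalLeftAction C M]

theorem epi_actionLeftAdjunction_counit {p q : C} [ExactPairing q p] [Epi (ε_ q p)]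
    [∀ m : M, PreservesFiniteColimits (actionRight C m)] (m : M) :
    Epi ((actionLeftAdjunction M q p).counit.app m) := by
  have : Epi (ε_ q p ⊵ₗ m) := inferInstanceAs (Epi ((actionRight C m).map (ε_ q p)))
  exact inferInstanceAs (Epi ((αₗ p q m).inv ≫ ε_ q p ⊵ₗ m ≫ (λₗ[C] m).hom))

instance preservesFiniteLimits_actionLeft (X : C) [HasRightDual X] :
    PreservesFiniteLimits (actionLeft M X) :=
  have := (actionLeftAdjunction M X Xᘁ).rightAdjoint_preservesLimits
  inferInstance

/-- Maps into q ⊙ m correspond to maps p ⊙ - ⟶ m. The exact functor p ⊙ - has projective values, so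
it turns monomorphisms into split ones, along which maps extend. -/
theorem injective_actionObj [Abelian M] (hM : IsExactModuleCategory C M) {p q : C}
    [ExactPairing q p] [HasRightDual p] [Projective p] [(actionLeft M p).Additive] (m : M) :
    Injective (q ⊙ₗ m) where
  factors {A B} f g hg := by
    let S : ShortComplex M := ShortComplex.mk g (cokernel.π g) (cokernel.condition g)
    have hS : S.ShortExact :=
      { exact := ShortComplex.exact_of_g_is_cokernel _ (cokernelIsCokernel g) }
    let adj := actionLeftAdjunction M q p
    have := adj.leftAdjoint_preservesColimits
    have : Projective (S.map (actionLeft M p)).X₃ := hM p _ inferInstance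
    let σ := (hS.map_of_exact (actionLeft M p)).splittingOfProjective
    have h : (actionLeft M p).map g ≫ σ.r = 𝟙 _ := σ.f_r
    refine ⟨adj.homEquiv _ _ (σ.r ≫ (adj.homEquiv _ _).symm f), ?_⟩
    refine (adj.homEquiv_naturality_left _ _).symm.trans ?_
    refine (congr_arg (adj.homEquiv A m) ?_).trans (Equiv.apply_symm_apply _ f)
    refine (Category.assoc _ _ _).symm.trans ?_
    rw [h]
    exact Category.id_comp _

end DualAction

/-! ### Decomposing an exact module category. -/

section Decomposition

open MonoidalLeftAction

variable (C : Type u₁) [Category.{v₁} C] [MonoidalCategory C]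
  {M : Type u₂} [Category.{v₂} M] [MonoidalLeftAction C M]

/-- The objects generated by `s` under the action of `C`: the quotients of the objects
`X ⊙ s`. -/
def actionGenerated (s : M) : ObjectProperty M :=
  fun m => ∃ (X : C) (f : X ⊙ₗ s ⟶ m), Epi f

/-- The objects `m` such that there is no non-zero morphism from an object `X ⊙ s` to `m`. -/
def actionOrthogonal [HasZeroMorphisms M] (s : M) : ObjectProperty M :=
  fun m => ∀ (X : C) (f : X ⊙ₗ s ⟶ m), f = 0

variable {C} {s m n : M}

theorem actionGenerated.of_epi (hm : actionGenerated C s m) (f : m ⟶ n) [Epi f] :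
    actionGenerated C s n := by
  obtain ⟨X, g, _⟩ := hm
  exact ⟨X, g ≫ f, inferInstance⟩

variable (C s) in
theorem actionGenerated_self : actionGenerated C s s :=
  ⟨𝟙_ C, (λₗ[C] s).hom, inferInstance⟩

theorem actionGenerated.action (hm : actionGenerated C s m) (Y : C)
    [PreservesFiniteColimits (actionLeft M Y)] : actionGenerated C s (Y ⊙ₗ m) := by
  obtain ⟨X, g, _⟩ := hm
  have : Epi (Y ⊴ₗ g) := inferInstanceAs (Epi ((actionLeft M Y).map g))
  exact ⟨Y ⊗ X, (αₗ Y X s).hom ≫ Y ⊴ₗ g, inferInstance⟩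

theorem actionOrthogonal.of_mono [HasZeroMorphisms M] (hn : actionOrthogonal C s n) (f : m ⟶ n)
    [Mono f] : actionOrthogonal C s m := fun X g => by
  rw [← cancel_mono f, zero_comp, hn X (g ≫ f)]

theorem actionGenerated.hom_eq_zero [HasZeroMorphisms M] (hm : actionGenerated C s m)
    (hn : actionOrthogonal C s n) (f : m ⟶ n) : f = 0 := by
  obtain ⟨X, g, _⟩ := hm
  rw [← cancel_epi g, comp_zero, hn X (g ≫ f)]

/-- By duality, Y can be moved to the source, where it is absorbed into X. -/
theorem actionOrthogonal.action [Preadditive M] (hm : actionOrthogonal C s m) (Y : C)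
    [HasRightDual Y] [(actionLeft M Y).Additive] : actionOrthogonal C s (Y ⊙ₗ m) := fun X f => by
  let adj := actionLeftAdjunction M Y Yᘁ
  have h : (adj.homEquiv (X ⊙ₗ s) m).symm f = 0 := by
    exact (cancel_epi (αₗ Yᘁ X s).hom).1 ((hm _ _).trans comp_zero.symm)
  refine ((adj.homEquiv (X ⊙ₗ s) m).apply_symm_apply f).symm.trans ?_
  rw [h, Adjunction.homEquiv_unit]
  refine (congr_arg (adj.unit.app (X ⊙ₗ s) ≫ ·) ((actionLeft M Y).map_zero _ _)).trans ?_
  exact comp_zero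

section

variable [Abelian M]

/-- A map from X ⊙ s can be tested on P ⊙ s with P a projective cover of X by an epimorphism; P ⊙ s
is projective, so the map lifts along f. -/
theorem actionOrthogonal.of_epi [EnoughProjectives C] (hM : IsExactModuleCategory C M)
    [∀ m : M, PreservesFiniteColimits (actionRight C m)]
    (hm : actionOrthogonal C s m) (f : m ⟶ n) [Epi f] : actionOrthogonal C s n := fun X g => by
  have : Epi (Projective.π X ⊵ₗ s) :=
    inferInstanceAs (Epi ((actionRight C s).map (Projective.π X)))
  have := hM (Projective.over X) s inferInstance
  rw [← cancel_epi (Projective.π X ⊵ₗ s), comp_zero,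
    ← Projective.factorThru_comp (Projective.π X ⊵ₗ s ≫ g) f,
    hm _ (Projective.factorThru (Projective.π X ⊵ₗ s ≫ g) f), zero_comp]

variable [∀ m : M, PreservesFiniteColimits (actionRight C m)]

theorem actionOrthogonal.cokernel [EnoughProjectives C] (hM : IsExactModuleCategory C M)
    {Z : C} (e : Z ⊙ₗ s ⟶ m) (he : ∀ (X : C) (f : X ⊙ₗ s ⟶ m), ∃ g : X ⟶ Z, g ⊵ₗ s ≫ e = f) :
    actionOrthogonal C s (cokernel e) := fun X g => by
  have : Epi (Projective.π X ⊵ₗ s) :=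
    inferInstanceAs (Epi ((actionRight C s).map (Projective.π X)))
  have := hM (Projective.over X) s inferInstance
  rw [← cancel_epi (Projective.π X ⊵ₗ s), comp_zero,
    ← Projective.factorThru_comp (Projective.π X ⊵ₗ s ≫ g) (cokernel.π e)]
  obtain ⟨h, hh⟩ := he _ (Projective.factorThru (Projective.π X ⊵ₗ s ≫ g) (cokernel.π e))
  rw [← hh, Category.assoc, cokernel.condition, comp_zero]

end

variable [Abelian C] [RigidCategory C] [MonoidalPreadditive C] [Simple (𝟙_ C)] [Abelian M]
  [∀ X : C, (actionLeft M X).Additive] [∀ X : C, PreservesFiniteColimits (actionLeft M X)]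
  [∀ m : M, PreservesFiniteColimits (actionRight C m)] {p : C}

/-- The image of f is orthogonal as a quotient of m. It is also generated: after acting by the dual
of p it is injective, hence a quotient of an object generated by s, and evaluation maps p ⊙ (ᘁp) ⊙
image f onto the image. So its identity vanishes. -/
theorem actionOrthogonal.hom_eq_zero (hp : IsFiniteProgenerator p)
    (hM : IsExactModuleCategory C M) (hm : actionOrthogonal C s m) (hn : actionGenerated C s n)
    (f : m ⟶ n) : f = 0 := by
  have := hp.enoughProjectives
  have := hp.projective
  have : Epi (ε_ (ᘁp) p) := hp.epi_evaluation
  let i := Abelian.image.ι f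
  have : Mono ((ᘁp) ⊴ₗ i) := inferInstanceAs (Mono ((actionLeft M (ᘁp)).map i))
  have := injective_actionObj hM (p := p) (q := (ᘁp : C)) (Abelian.image f)
  let r : (ᘁp) ⊙ₗ n ⟶ (ᘁp) ⊙ₗ Abelian.image f := Injective.factorThru (𝟙 _) ((ᘁp) ⊴ₗ i)
  have hr : (ᘁp) ⊴ₗ i ≫ r = 𝟙 _ := Injective.comp_factorThru _ _
  have : Epi r := epi_of_epi_fac hr
  let c : p ⊙ₗ (ᘁp) ⊙ₗ Abelian.image f ⟶ Abelian.image f :=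
    (actionLeftAdjunction M (ᘁp) p).counit.app (Abelian.image f)
  have : Epi c := epi_actionLeftAdjunction_counit (Abelian.image f)
  have h₁ : actionGenerated C s (Abelian.image f) :=
    (((hn.action (ᘁp)).of_epi r).action p).of_epi c
  have h₂ : actionOrthogonal C s (Abelian.image f) := hm.of_epi hM (Abelian.factorThruImage f)
  rw [← Abelian.image.fac f, ← Category.id_comp (Abelian.image.ι f), h₁.hom_eq_zero h₂ (𝟙 _),
    zero_comp, comp_zero]

/-- The universal map e has generated image a and orthogonal cokernel. The sequence splits after
acting by the dual of p, which supplies an orthogonal subobject b covering the cokernel. Then a and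
b span m, and their overlap is an orthogonal object mapping to a, hence zero. -/
theorem exists_iso_biprod (hp : IsFiniteProgenerator p) (hM : IsExactModuleCategory C M)
    {Z : C} (e : Z ⊙ₗ s ⟶ m) (he : ∀ (X : C) (f : X ⊙ₗ s ⟶ m), ∃ g : X ⟶ Z, g ⊵ₗ s ≫ e = f) :
    ∃ a b : M, actionGenerated C s a ∧ actionOrthogonal C s b ∧ Nonempty (m ≅ a ⊞ b) := by
  have := hp.enoughProjectives
  have := hp.projective
  have : Epi (ε_ (ᘁp) p) := hp.epi_evaluation
  let adj := actionLeftAdjunction M (ᘁp) p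
  have (x : M) : Epi (adj.counit.app x) := epi_actionLeftAdjunction_counit x
  let a := Abelian.image e
  have ha : actionGenerated C s a := ⟨Z, Abelian.factorThruImage e, inferInstance⟩
  have hc := actionOrthogonal.cokernel hM e he
  let S : ShortComplex M := ShortComplex.mk (Abelian.image.ι e) (cokernel.π e)
    (kernel.condition _)
  have hS : S.ShortExact := { exact := ShortComplex.exact_of_f_is_kernel _ (kernelIsKernel _) }
  have : Injective (S.map (actionLeft M (ᘁp))).X₁ :=
    injective_actionObj hM (p := p) (q := (ᘁp : C)) _
  let σ := (hS.map_of_exact (actionLeft M (ᘁp))).splittingOfInjective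
  have hσ : σ.s ≫ (actionLeft M (ᘁp)).map (cokernel.π e) = 𝟙 _ := σ.s_g
  -- The transpose of the splitting lifts the counit at the cokernel to m.
  let t : p ⊙ₗ (ᘁp) ⊙ₗ cokernel e ⟶ m := (actionLeft M p).map σ.s ≫ adj.counit.app m
  have ht : t ≫ cokernel.π e = adj.counit.app (cokernel e) := by
    have h := adj.counit.naturality (cokernel.π e)
    refine (Category.assoc _ _ _).trans ?_
    refine (congr_arg ((actionLeft M p).map σ.s ≫ ·) h.symm).trans ?_
    refine (Category.assoc _ _ _).symm.trans ?_
    refine (congr_arg (· ≫ adj.counit.app (cokernel e))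
      (((actionLeft M p).map_comp _ _).symm.trans (congr_arg (actionLeft M p).map hσ))).trans ?_
    refine (congr_arg (· ≫ adj.counit.app (cokernel e)) ((actionLeft M p).map_id _)).trans ?_
    exact Category.id_comp _
  let b := Abelian.image t
  have hb : actionOrthogonal C s b :=
    ((hc.action (ᘁp)).action p).of_epi hM (Abelian.factorThruImage t)
  let d : a ⊞ b ⟶ m := biprod.desc (Abelian.image.ι e) (Abelian.image.ι t)
  have : Epi d := by
    refine Preadditive.epi_of_cancel_zero _ fun u hu => ?_
    have h₁ : Abelian.image.ι e ≫ u = 0 := by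
      rw [← biprod.inl_desc (Abelian.image.ι e) (Abelian.image.ι t), Category.assoc, hu, comp_zero]
    have h₂ : Abelian.image.ι t ≫ u = 0 := by
      rw [← biprod.inr_desc (Abelian.image.ι e) (Abelian.image.ι t), Category.assoc, hu, comp_zero]
    have h₃ : e ≫ u = 0 := by rw [← Abelian.image.fac e, Category.assoc, h₁, comp_zero]
    have h₄ : t ≫ u = 0 := by rw [← Abelian.image.fac t, Category.assoc, h₂, comp_zero]
    rw [← cokernel.π_desc e u h₃, ← Category.assoc, ht] at h₄
    rw [← cokernel.π_desc e u h₃,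
      (cancel_epi (adj.counit.app (cokernel e))).1 (h₄.trans comp_zero.symm), comp_zero]
  have : Mono d := by
    refine Preadditive.mono_of_cancel_zero _ fun {z} u hu => ?_
    let w := kernel.ι d
    have hw : w ≫ biprod.fst ≫ Abelian.image.ι e + w ≫ biprod.snd ≫ Abelian.image.ι t = 0 := by
      rw [← Preadditive.comp_add, ← biprod.desc_eq]
      exact kernel.condition d
    have : Mono (w ≫ biprod.snd) := by
      refine Preadditive.mono_of_cancel_zero _ fun {z} y hy => ?_
      have h₁ : y ≫ w ≫ biprod.fst = 0 := by
        rw [← cancel_mono (Abelian.image.ι e), zero_comp]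
        have h := congr_arg (y ≫ ·) hw
        simp only [Preadditive.comp_add, comp_zero] at h
        have h' : y ≫ w ≫ biprod.snd ≫ Abelian.image.ι t = 0 := by
          rw [← Category.assoc w, ← Category.assoc, hy, zero_comp]
        rw [h', add_zero] at h
        simpa using h
      rw [← cancel_mono w, zero_comp]
      exact biprod.hom_ext _ _ (by simpa using h₁) (by simpa using hy)
    have h₁ : w ≫ biprod.fst = 0 := (hb.of_mono (w ≫ biprod.snd)).hom_eq_zero hp hM ha _
    have h₂ : w ≫ biprod.snd = 0 := by
      rw [← cancel_mono (Abelian.image.ι t), zero_comp]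
      rw [← Category.assoc, h₁, zero_comp, zero_add, ← Category.assoc] at hw
      exact hw
    have h₃ : w = 0 := biprod.hom_ext _ _ (by simpa using h₁) (by simpa using h₂)
    rw [← kernel.lift_ι d u hu]
    change _ ≫ w = 0
    rw [h₃, comp_zero]
  have := isIso_of_mono_of_epi d
  exact ⟨a, b, ha, hb, ⟨(asIso d).symm⟩⟩

theorem isModuleDecomposition_action (hp : IsFiniteProgenerator p)
    (hM : IsExactModuleCategory C M) (s : M)
    (hs : ∀ m : M, ∃ (Z : C) (e : Z ⊙ₗ s ⟶ m), ∀ (X : C) (f : X ⊙ₗ s ⟶ m),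
      ∃ g : X ⟶ Z, g ⊵ₗ s ≫ e = f) :
    IsModuleDecomposition C (actionGenerated C s) (actionOrthogonal C s) where
  replete₁ := ⟨fun e h => h.of_epi e.hom⟩
  replete₂ := ⟨fun e h => h.of_mono e.inv⟩
  action₁ X m hm := hm.action X
  action₂ X m hm := hm.action X
  hom₁₂ f h₁ h₂ := h₁.hom_eq_zero h₂ f
  hom₂₁ f h₁ h₂ := h₂.hom_eq_zero hp hM h₁ f
  exists_directSum m := by
    obtain ⟨Z, e, he⟩ := hs m
    obtain ⟨a, b, ha, hb, ⟨i⟩⟩ := exists_iso_biprod hp hM e he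
    exact ⟨a, b, BinaryBiproduct.bicone a b, ha, hb, ⟨BinaryBiproduct.isBilimit a b⟩, ⟨i⟩⟩

theorem IsIndecomposableModuleCategory.exists_hom_ne_zero
    (h : IsIndecomposableModuleCategory C M) (hp : IsFiniteProgenerator p)
    (hM : IsExactModuleCategory C M) (iHom : InternalHom C M) (hm : ¬ IsZero m)
    (hn : ¬ IsZero n) : ∃ (X : C) (f : X ⊙ₗ m ⟶ n), f ≠ 0 := by
  have hs (x : M) : ∃ (Z : C) (e : Z ⊙ₗ m ⟶ x), ∀ (X : C) (f : X ⊙ₗ m ⟶ x),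
      ∃ g : X ⟶ Z, g ⊵ₗ m ≫ e = f := by
    let adj := iHom.adj.adj m
    refine ⟨_, adj.counit.app x, fun X f => ⟨adj.homEquiv X x f, ?_⟩⟩
    refine Eq.trans ?_ ((adj.homEquiv X x).symm_apply_apply f)
    exact (adj.homEquiv_counit ..).symm
  rcases h _ _ (isModuleDecomposition_action hp hM m hs) with h | h
  · exact absurd (h m (actionGenerated_self C m)) hm
  · by_contra! h'
    exact hn (h n h')

end Decomposition

/-! ### Colimits and cokernels of right exact functors. -/

section RexColimits

variable {k : Type w} [Field k] {M : Type u₂} [Category.{v₂} M] [Preadditive M] [Linear k M]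

/-- Colimits of functors are pointwise: linearity is tested on the coprojections, and right
exactness holds because colimits commute with colimits. -/
instance linearRightExact_isClosedUnderColimitsOfShape (J : Type*) [Category* J]
    [HasColimitsOfShape J M] : (linearRightExact k M).IsClosedUnderColimitsOfShape J where
  colimitsOfShape_le := by
    rintro G ⟨h⟩
    have hX (X : M) := isColimitOfPreserves ((evaluation M M).obj X) h.isColimit
    have hG {X Y : M} (g : X ⟶ Y) (j : J) :
        (h.ι.app j).app X ≫ G.map g = (h.diag.obj j).map g ≫ (h.ι.app j).app Y :=
      ((h.ι.app j).naturality g).symm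
    refine ⟨⟨fun {X Y f g} => (hX X).hom_ext fun j => ?_⟩,
      ⟨fun {X Y} f r => (hX X).hom_ext fun j => ?_⟩, ?_⟩
    · have := (h.prop_diag_obj j).1
      change (h.ι.app j).app X ≫ G.map (f + g) = (h.ι.app j).app X ≫ (G.map f + G.map g)
      rw [hG, Functor.map_add, Preadditive.add_comp, Preadditive.comp_add, hG, hG]
    · have := (h.prop_diag_obj j).1
      have := (h.prop_diag_obj j).2.1
      change (h.ι.app j).app X ≫ G.map (r • f) = (h.ι.app j).app X ≫ (r • G.map f)
      rw [hG, Functor.map_smul, Linear.smul_comp, Linear.comp_smul, hG]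
    · have hd (j : J) : PreservesFiniteColimits (h.diag.obj j) := (h.prop_diag_obj j).2.2
      refine ⟨fun K _ _ => ?_⟩
      have : PreservesColimitsOfShape K h.diag.flip := ⟨fun {F} => ⟨fun {c} hc =>
        ⟨evaluationJointlyReflectsColimits _
          fun j => isColimitOfPreserves (h.diag.obj j) hc⟩⟩⟩
      let e : h.diag.flip ⋙ colim ≅ G :=
        NatIso.ofComponents
          (fun X => (colimit.isColimit (h.diag.flip.obj X)).coconePointUniqueUpToIso (hX X))
          (fun {X Y} f => colimit.hom_ext fun j => by
            simp)
      exact preservesColimitsOfShape_of_natIso e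

end RexColimits

section RexCokernels

variable {k : Type w} [Field k] {M : Type u₂} [Category.{v₂} M] [Abelian M] [Linear k M]
  {F G : Rex k M} (α : F ⟶ G) (m : M)

variable (k) in
/-- The evaluation functor at an object on right exact functors. -/
def rexEvaluation : Rex k M ⥤ M := (linearRightExact k M).ι ⋙ (evaluation M M).obj m

instance : (rexEvaluation k m).PreservesZeroMorphisms := ⟨fun _ _ => rfl⟩

instance : PreservesFiniteColimits (rexEvaluation k m) :=
  ⟨fun _ _ _ => inferInstanceAs
    (PreservesColimitsOfShape _ ((linearRightExact k M).ι ⋙ (evaluation M M).obj m))⟩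

instance epi_cokernel_π_hom_app : Epi ((cokernel.π α).hom.app m) :=
  inferInstanceAs (Epi ((rexEvaluation k m).map (cokernel.π α)))

theorem exists_cokernel_π_hom_app_comp_eq {n : M} (u : G.obj.obj m ⟶ n)
    (hu : α.hom.app m ≫ u = 0) :
    ∃ v : (cokernel α).obj.obj m ⟶ n, (cokernel.π α).hom.app m ≫ v = u :=
  ⟨(isColimitOfHasCokernelOfPreservesColimit (rexEvaluation k m) α).desc (CokernelCofork.ofπ u hu),
    (isColimitOfHasCokernelOfPreservesColimit (rexEvaluation k m) α).fac (CokernelCofork.ofπ u hu)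
      WalkingParallelPair.one⟩

end RexCokernels

/-! ### Existence of the ends. -/

section ExistsEnd

open MonoidalLeftAction

variable {k : Type w} [Field k]
  {C : Type u₁} [Category.{v₁} C] [Abelian C] [Linear k C] [MonoidalCategory C]
  {M : Type u₂} [Category.{v₂} M] [Abelian M] [Linear k M] [MonoidalLeftAction C M]
  [IsFiniteModuleCategory k C M]

theorem IsFiniteProgenerator.finite_rexHom {q : M} (hq : IsFiniteProgenerator q)
    [∀ X Y : M, Module.Finite k (X ⟶ Y)] (F G : Rex k M) : Module.Finite k (F ⟶ G) := by
  have := F.property.1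
  have := F.property.2.2
  let e : (F ⟶ G) →ₗ[k] (F.obj.obj q ⟶ G.obj.obj q) :=
    { toFun t := t.hom.app q
      map_add' _ _ := rfl
      map_smul' _ _ := rfl }
  refine Module.Finite.of_injective e fun s t hst => ?_
  have hst' : s.hom.app q = t.hom.app q := hst
  ext m
  rw [← sub_eq_zero]
  refine hq.map_hom_eq_zero F.obj _ fun x => ?_
  rw [Preadditive.comp_sub, sub_eq_zero, s.hom.naturality, t.hom.naturality, hst']

theorem actionFunctor_map_comp_eq_zero {X Y : C} (f : X ⟶ Y) [Epi f] {F : Rex k M}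
    (u : (actionFunctor k C M).obj Y ⟶ F) (hu : (actionFunctor k C M).map f ≫ u = 0) : u = 0 := by
  ext m
  have : PreservesFiniteColimits (actionRight C m) :=
    IsFiniteModuleCategory.rightExact_actionRight k m
  exact (cancel_epi ((actionRight C m).map f)).1
    ((congr_arg (fun t => t.hom.app m) hu).trans comp_zero.symm)

theorem exists_actionFunctor_map_cokernel_π_comp_eq {X Y : C} (f : X ⟶ Y) {F : Rex k M}
    (u : (actionFunctor k C M).obj Y ⟶ F) (hu : (actionFunctor k C M).map f ≫ u = 0) :
    ∃ v : (actionFunctor k C M).obj (cokernel f) ⟶ F,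
      (actionFunctor k C M).map (cokernel.π f) ≫ v = u := by
  have h₁ (m : M) : PreservesFiniteColimits (actionRight C m) :=
    IsFiniteModuleCategory.rightExact_actionRight k m
  have h₂ (m : M) : (actionRight C m).Additive := IsFiniteModuleCategory.additive_actionRight k m
  have (m : M) : ∃ v : cokernel f ⊙ₗ m ⟶ F.obj.obj m, cokernel.π f ⊵ₗ m ≫ v = u.hom.app m :=
    (actionRight C m).exists_map_cokernel_π_comp_eq f (u.hom.app m)
    (congr_arg (fun t => t.hom.app m) hu)
  choose v hv using this
  refine ⟨ObjectProperty.homMk { app := v, naturality := fun m n g => ?_ }, ?_⟩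
  · refine (cancel_epi ((actionRight C m).map (cokernel.π f))).1 ?_
    change cokernel.π f ⊵ₗ m ≫ cokernel f ⊴ₗ g ≫ v n = cokernel.π f ⊵ₗ m ≫ v m ≫ F.obj.map g
    rw [← action_exchange_assoc, hv, ← Category.assoc, hv]
    exact u.hom.naturality g
  · ext m
    exact hv m

theorem IsFiniteProgenerator.hasEnd_twist {p : C} (hp : IsFiniteProgenerator p) {q : M}
    (hq : IsFiniteProgenerator q) [∀ X Y : C, Module.Finite k (X ⟶ Y)]
    [∀ X Y : M, Module.Finite k (X ⟶ Y)] (iHom : InternalHom C M) (F : Rex k M) :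
    HasEnd (iHom.twist.obj F) := by
  have := hq.finite_rexHom (k := k) ((actionFunctor k C M).obj p) F
  obtain ⟨Z, x, hx⟩ := hp.exists_universal (k := k) (actionFunctor k C M) F
    (fun f _ u hu => actionFunctor_map_comp_eq_zero f u hu)
    (fun f u hu => exists_actionFunctor_map_cokernel_π_comp_eq f u hu)
  exact iHom.hasEnd_of_universal F x hx

end ExistsEnd

/-! ### Lifting natural transformations and exactness of the right adjoint. -/

section Lifting

open TensorProduct

variable {k : Type w} [Field k] {M : Type u₂} [Category.{v₂} M] [Abelian M] [Linear k M] {p : M}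
  {F G H : M ⥤ M} [F.Additive] [F.Linear k] [G.Additive] [G.Linear k] [H.Additive] [H.Linear k]
  [PreservesFiniteColimits F]

theorem EvalAt.exists_lift (hp : IsFiniteProgenerator p)
    [Module.Projective (End p ⊗[k] (End p)ᵐᵒᵖ) (EvalAt p F)] (β : G ⟶ H) (t : F ⟶ H)
    (h : ∀ v : p ⟶ F.obj p, ∃ w : p ⟶ G.obj p, w ≫ β.app p = v ≫ t.app p) :
    ∃ s : F ⟶ G, s ≫ β = t := by
  let N := LinearMap.range (EvalAt.map (p := p) k β)
  let τ : EvalAt p F →ₗ[End p ⊗[k] (End p)ᵐᵒᵖ] N := (EvalAt.map k t).codRestrict N fun v => by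
    obtain ⟨w, hw⟩ := h v.hom
    exact ⟨EvalAt.mk w, EvalAt.ext hw⟩
  obtain ⟨φ, hφ⟩ := Module.projective_lifting_property (EvalAt.map (p := p) k β).rangeRestrict τ
    (LinearMap.surjective_rangeRestrict _)
  obtain ⟨s, hs⟩ := EvalAt.map_surjective hp φ
  refine ⟨s, EvalAt.map_injective (k := k) hp (LinearMap.ext fun v => EvalAt.ext ?_)⟩
  have h' : EvalAt.map k β (φ v) = EvalAt.map k t v := congr_arg Subtype.val congr($hφ v)
  rw [← hs] at h'
  simpa using congr_arg EvalAt.hom h'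

end Lifting

section Exactness

open MonoidalLeftAction TensorProduct

variable {k : Type w} [Field k] [IsAlgClosed k]
  {C : Type u₁} [Category.{v₁} C] [Abelian C] [Linear k C] [MonoidalCategory C]
  {M : Type u₂} [Category.{v₂} M] [Abelian M] [Linear k M] [MonoidalLeftAction C M]
  [IsFiniteModuleCategory k C M]

theorem IsExactModuleCategory.projective_evalAt (hM : IsExactModuleCategory C M) {q : M}
    (hq : IsFiniteProgenerator q) [∀ X Y : M, Module.Finite k (X ⟶ Y)] (P : C) [Projective P]
    [HasRightDual P] [(actionLeft M P).Additive] [(actionLeft M P).Linear k] :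
    Module.Projective (End q ⊗[k] (End q)ᵐᵒᵖ) (EvalAt q (actionLeft M P)) := by
  have : PreservesFiniteColimits (actionLeft M P) :=
    IsFiniteModuleCategory.rightExact_actionLeft k P
  have : Module.Finite k (End q) := inferInstanceAs (Module.Finite k (q ⟶ q))
  exact EvalAt.projective hq (actionLeft M P) fun m => hM P m inferInstance

theorem IsExactModuleCategory.exists_lift (hM : IsExactModuleCategory C M) {q : M}
    (hq : IsFiniteProgenerator q) [∀ X Y : M, Module.Finite k (X ⟶ Y)] (P : C) [Projective P]
    [HasRightDual P] {F G : Rex k M} (β : F ⟶ G) (t : (actionFunctor k C M).obj P ⟶ G)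
    (h : ∀ v : q ⟶ P ⊙ₗ q, ∃ w : q ⟶ F.obj.obj q, w ≫ β.hom.app q = v ≫ t.hom.app q) :
    ∃ s : (actionFunctor k C M).obj P ⟶ F, s ≫ β = t := by
  have := F.property.1
  have := F.property.2.1
  have := G.property.1
  have := G.property.2.1
  have : (actionLeft M P).Additive := IsFiniteModuleCategory.additive_actionLeft k P
  have : (actionLeft M P).Linear k := IsFiniteModuleCategory.linear_actionLeft P
  have : PreservesFiniteColimits (actionLeft M P) :=
    IsFiniteModuleCategory.rightExact_actionLeft k P
  have := hM.projective_evalAt (k := k) hq P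
  obtain ⟨s, hs⟩ := EvalAt.exists_lift (k := k) (F := actionLeft M P) hq β.hom t.hom h
  exact ⟨ObjectProperty.homMk s, ObjectProperty.hom_ext _ hs⟩

/-- Cokernels in C can be tested by maps from p, and Hom(p, R(F)) = Hom(ρ(p), F). Lifting out of
ρ(p) through `exists_lift` shows that R preserves cokernels. -/
theorem IsExactModuleCategory.preservesFiniteColimits_of_adjunction [RightRigidCategory C]
    (hM : IsExactModuleCategory C M) {p : C} (hp : IsFiniteProgenerator p) {q : M}
    (hq : IsFiniteProgenerator q) [∀ X Y : M, Module.Finite k (X ⟶ Y)] {R : Rex k M ⥤ C}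
    (adj : actionFunctor k C M ⊣ R) : PreservesFiniteColimits R := by
  have := hp.projective
  have := hq.projective
  have := adj.right_adjoint_additive
  have : HasCoequalizers (Rex k M) := inferInstance
  have : HasFiniteCoproducts (Rex k M) := ⟨fun _ => inferInstance⟩
  have : HasBinaryBiproducts (Rex k M) := HasBinaryBiproducts.of_hasBinaryCoproducts
  have {F G : Rex k M} (α : F ⟶ G) : PreservesColimit (parallelPair α 0) R := by
    refine preservesColimit_of_preserves_colimit_cocone (cokernelIsCokernel α)
      ((CokernelCofork.isColimitMapCoconeEquiv _ R).2 ?_)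
    have : Epi (R.map (cokernel.π α)) := hp.epi_of_forall _ fun y => by
      obtain ⟨s, hs⟩ := hM.exists_lift hq p (cokernel.π α) ((adj.homEquiv _ _).symm y)
        fun v => ⟨Projective.factorThru _ _, Projective.factorThru_comp _ _⟩
      refine ⟨adj.homEquiv _ _ s, ?_⟩
      rw [← adj.homEquiv_naturality_right, hs, Equiv.apply_symm_apply]
    have h (x : p ⟶ R.obj G) (hx : x ≫ R.map (cokernel.π α) = 0) :
        ∃ y : p ⟶ R.obj F, y ≫ R.map α = x := by
      have hx' : (adj.homEquiv _ _).symm x ≫ cokernel.π α = 0 := by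
        rw [← adj.homEquiv_naturality_right_symm, hx, Adjunction.homEquiv_counit, Functor.map_zero,
          zero_comp]
      obtain ⟨s, hs⟩ := hM.exists_lift hq p α ((adj.homEquiv _ _).symm x) fun v =>
        exists_comp_eq_of_forall_exists (α.hom.app q) ((cokernel.π α).hom.app q)
          (fun u hu => exists_cokernel_π_hom_app_comp_eq α q u hu) _ (by
            have h := congr_arg (fun t => t.hom.app q) hx'
            exact (Category.assoc _ _ _).trans ((congr_arg (v ≫ ·) h).trans comp_zero))
      refine ⟨adj.homEquiv _ _ s, ?_⟩
      rw [← adj.homEquiv_naturality_right, hs, Equiv.apply_symm_apply]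
    have hk {W : C} (u : R.obj G ⟶ W) (hu : R.map α ≫ u = 0) :
        kernel.ι (R.map (cokernel.π α)) ≫ u = 0 := hp.hom_eq_zero _ fun x => by
      obtain ⟨y, hy⟩ := h (x ≫ kernel.ι _) (by
        rw [Category.assoc, kernel.condition, comp_zero])
      rw [← Category.assoc, ← hy, Category.assoc, hu, comp_zero]
    exact CokernelCofork.IsColimit.ofπ _
      ((R.map_comp _ _).symm.trans
        ((congr_arg R.map (cokernel.condition α)).trans (R.map_zero _ _)))
      (fun u hu => Abelian.epiDesc (R.map (cokernel.π α)) u (hk u hu))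
      (fun u hu => Abelian.comp_epiDesc (R.map (cokernel.π α)) u (hk u hu))
      (fun u hu v hv => (cancel_epi (R.map (cokernel.π α))).1
        (hv.trans (Abelian.comp_epiDesc (R.map (cokernel.π α)) u (hk u hu)).symm))
  exact R.preservesFiniteColimits_of_preservesCokernels

end Exactness

/-! ### Non-zero bimodule maps by averaging. -/

section Averaging

open TensorProduct

/-- Take the last non-zero term of the chain V, I • V, I² • V and so on. -/
theorem Submodule.exists_le_smul_eq_bot {R Y : Type*} [Ring R] [AddCommGroup Y] [Module R Y]
    (I : Ideal R) : ∀ (n : ℕ) (V : Submodule R Y), V ≠ ⊥ → I ^ n = ⊥ →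
      ∃ U ≤ V, U ≠ ⊥ ∧ I • U = ⊥ := by
  suffices ∀ (n : ℕ) (V : Submodule R Y), V ≠ ⊥ → I ^ n • V = ⊥ → ∃ U ≤ V, U ≠ ⊥ ∧ I • U = ⊥ from
    fun n V hV hI => this n V hV (by rw [hI, Submodule.bot_smul])
  intro n
  induction n with
  | zero => exact fun V hV h => absurd (by rwa [Submodule.pow_zero, Submodule.one_smul] at h) hV
  | succ n ih =>
    intro V hV h
    by_cases hI : I • V = ⊥
    · exact ⟨V, le_rfl, hV, hI⟩
    · rw [Submodule.pow_succ, Submodule.mul_smul] at h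
      obtain ⟨U, hU, h'⟩ := ih _ hI h
      exact ⟨U, hU.trans (Submodule.smul_le.2 fun r _ v hv => V.smul_mem r hv), h'⟩

instance {k : Type w} [Field k] {E : Type u₁} [Ring E] [Algebra k E]
    (U : MatrixUnitsModJacobson k E) (i : Fin U.n) : NeZero (U.d i) :=
  U.d_pos i

variable {k : Type w} [Field k] {E : Type u₁} [Ring E] [Algebra k E] {A : Type u₁} [Ring A]
  [Algebra k A] {X Y : Type*} [AddCommGroup X] [AddCommGroup Y] [Module (E ⊗[k] A) X]
  [Module (E ⊗[k] A) Y] (U : MatrixUnitsModJacobson k E)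

/-- On a non-zero part of V killed by J the sum of all u w acts as the identity, so some w_ij y is
non-zero; it is fixed by w_i0 because w_i0 w_ij is w_ij modulo J. -/
theorem MatrixUnitsModJacobson.exists_mem_smul_eq_self [Module.Finite k E]
    {V : Submodule (E ⊗[k] A) Y} (hV : V ≠ ⊥) : ∃ (i : Fin U.n) (v : Y), v ∈ V ∧ v ≠ 0 ∧
      (∀ r ∈ Ring.jacobson E, (r ⊗ₜ[k] (1 : A)) • v = 0) ∧ (U.w i 0 ⊗ₜ[k] (1 : A)) • v = v := by
  obtain ⟨n, hn⟩ := exists_jacobsonIdeal_pow_eq_bot (E := E) k A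
  obtain ⟨W, hW, hW₀, hJ⟩ := Submodule.exists_le_smul_eq_bot _ n V hV hn
  have hJ' (r) (hr : r ∈ Ring.jacobson E) (y) (hy : y ∈ W) : (r ⊗ₜ[k] (1 : A)) • y = 0 := by
    rw [← Submodule.mem_bot (E ⊗[k] A), ← hJ]
    exact Submodule.smul_mem_smul (tmul_one_mem_jacobsonIdeal k A hr) hy
  have hc (a b : E) (h : a - b ∈ Ring.jacobson E) (y) (hy : y ∈ W) :
      (a ⊗ₜ[k] (1 : A)) • y = (b ⊗ₜ[k] (1 : A)) • y := by
    rw [← sub_eq_zero, ← sub_smul, ← TensorProduct.sub_tmul, hJ' _ h y hy]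
  obtain ⟨y, hy, hy₀⟩ := W.ne_bot_iff.1 hW₀
  obtain ⟨i, j, hij⟩ : ∃ i j, (U.w i j ⊗ₜ[k] (1 : A)) • y ≠ 0 := by
    by_contra! h
    apply hy₀
    have := hc _ _ U.sum_u_mul_w y hy
    rw [← Algebra.TensorProduct.one_def, one_smul] at this
    rw [← this, TensorProduct.sum_tmul, Finset.sum_smul]
    refine Finset.sum_eq_zero fun i _ => ?_
    rw [TensorProduct.sum_tmul, Finset.sum_smul]
    refine Finset.sum_eq_zero fun j _ => ?_
    rw [← one_mul (1 : A), ← Algebra.TensorProduct.tmul_mul_tmul, mul_smul, h, smul_zero]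
  refine ⟨i, (U.w i j ⊗ₜ[k] (1 : A)) • y, hW (W.smul_mem _ hy), hij,
    fun r hr => hJ' r hr _ (W.smul_mem _ hy), ?_⟩
  rw [← mul_smul, Algebra.TensorProduct.tmul_mul_tmul, one_mul, hc _ _ (U.zero_mul_w i j) y hy]

/-- Recovering f from its average shows that averaging does not destroy it: on w_i0 x only the term
j = 0 survives. -/
theorem MatrixUnitsModJacobson.exists_linearMap_apply_smul_eq (f : X →+ Y)
    (hf : ∀ (a : A) x, f (((1 : E) ⊗ₜ[k] a) • x) = ((1 : E) ⊗ₜ[k] a) • f x)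
    (hX : ∀ r ∈ Ring.jacobson E, ∀ x, f ((r ⊗ₜ[k] (1 : A)) • x) = 0)
    (hY : ∀ r ∈ Ring.jacobson E, ∀ x, (r ⊗ₜ[k] (1 : A)) • f x = 0) (i : Fin U.n)
    (hX' : ∀ x, f ((U.w i 0 ⊗ₜ[k] (1 : A)) • x) = f x)
    (hY' : ∀ x, (U.w i 0 ⊗ₜ[k] (1 : A)) • f x = f x) {V : Submodule (E ⊗[k] A) Y}
    (hV : ∀ x, f x ∈ V) :
    ∃ g : X →ₗ[E ⊗[k] A] Y, (∀ x, g ((U.w i 0 ⊗ₜ[k] (1 : A)) • x) = f x) ∧ ∀ x, g x ∈ V := by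
  obtain ⟨g, hg⟩ := U.exists_average f hf hX hY i
  refine ⟨g, fun x => ?_, fun x => ?_⟩
  · have hw (j) : f ((U.w i j ⊗ₜ[k] (1 : A)) • (U.w i 0 ⊗ₜ[k] (1 : A)) • x) =
        if j = 0 then f x else 0 := by
      have h := hX _ (U.w_mul_zero i j) x
      rw [TensorProduct.sub_tmul, sub_smul, map_sub, sub_eq_zero] at h
      rw [← mul_smul, Algebra.TensorProduct.tmul_mul_tmul, one_mul, h]
      split_ifs
      · exact hX' x
      · rw [TensorProduct.zero_tmul, zero_smul, map_zero]
    have hu := hY _ (U.u_zero i) x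
    rw [TensorProduct.sub_tmul, sub_smul, sub_eq_zero, hY'] at hu
    rw [hg]
    simp only [hw, smul_ite, smul_zero]
    rw [Finset.sum_ite_eq' Finset.univ, if_pos (Finset.mem_univ _), hu]
  · rw [hg]
    exact sum_mem fun j _ => V.smul_mem _ (hV _)

/-- With e = w_i0, the right ideal generated by J and 1 - e is proper: multiplying an expression of
1 by e on the left would put e in J. -/
theorem MatrixUnitsModJacobson.one_ne_sum {m : ℕ} (i : Fin U.n) (hi : U.w i 0 ∉ Ring.jacobson E)
    (r b : Fin m → E)
    (hr : ∀ l, r l ∈ (Ring.jacobson E).restrictScalars k ⊔ Submodule.span k {1 - U.w i 0}) :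
    (1 : E) ≠ ∑ l, r l * b l := fun h => by
  apply hi
  rw [← mul_one (U.w i 0), h, Finset.mul_sum]
  refine sum_mem fun l _ => ?_
  obtain ⟨s, hs, t, ht, hst⟩ := Submodule.mem_sup.1 (hr l)
  obtain ⟨c, rfl⟩ := Submodule.mem_span_singleton.1 ht
  rw [← mul_assoc]
  refine Ideal.mul_mem_right _ _ ?_
  rw [← hst, mul_add]
  refine add_mem (Ideal.mul_mem_left _ _ hs) ?_
  have h' := neg_mem (U.zero_mul_w i 0)
  rw [mul_smul_comm, mul_sub, mul_one, ← neg_sub]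
  exact ((Ring.jacobson E).restrictScalars k).smul_mem c h'

end Averaging

/-! ### Faithfulness of the right adjoint. -/

section Faithful

open MonoidalLeftAction TensorProduct

theorem IsFiniteProgenerator.exists_quotient_of_submodule {k : Type w} [Field k] {M : Type u₂}
    [Category.{v₂} M] [Abelian M] [Linear k M] {q : M} (hq : IsFiniteProgenerator q)
    [Module.Finite k (End q)] (K : Submodule k (End q)) :
    ∃ (N : M) (c : q ⟶ N), Epi c ∧ (∀ r ∈ K, (show q ⟶ q from r) ≫ c = 0) ∧
      (c = 0 → ∃ (n : ℕ) (r b : Fin n → End q), (∀ l, r l ∈ K) ∧ (1 : End q) = ∑ l, r l * b l) := by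
  have := hq.projective
  obtain ⟨n, r', hr'⟩ := Module.Finite.exists_fin (R := k) (M := K)
  let r (l : Fin n) : q ⟶ q := (r' l).1
  have hr : Submodule.span k (Set.range r) = K := by
    have := congr_arg (Submodule.map K.subtype) hr'
    rwa [Submodule.map_span, Submodule.map_subtype_top, ← Set.range_comp] at this
  let d : (⨁ fun _ : Fin n => q) ⟶ q := biproduct.desc r
  refine ⟨cokernel d, cokernel.π d, inferInstance, fun s hs => ?_, fun hc => ?_⟩
  · rw [← hr] at hs
    induction hs using Submodule.span_induction with
    | mem s hs =>
      obtain ⟨l, rfl⟩ := hs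
      rw [← biproduct.ι_desc r l, Category.assoc, cokernel.condition, comp_zero]
    | zero => exact zero_comp
    | add s t _ _ hs ht =>
      refine (Preadditive.add_comp _ _ _ _ _ _).trans ?_
      rw [hs, ht, add_zero]
    | smul c s _ hs =>
      refine (Linear.smul_comp _ _ _ _ _ _).trans ?_
      rw [hs, smul_zero]
  · obtain ⟨b, hb⟩ := exists_comp_eq_of_forall_exists d (cokernel.π d)
      (fun u hu => ⟨cokernel.desc d u hu, cokernel.π_desc d u hu⟩) (𝟙 q) (by rw [hc, comp_zero])
    refine ⟨n, r, fun l => (b ≫ biproduct.π _ l : q ⟶ q), fun l => (r' l).2, ?_⟩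
    change 𝟙 q = ∑ l, (b ≫ biproduct.π _ l) ≫ r l
    rw [← hb]
    simp only [d, biproduct.desc_eq, Preadditive.comp_sum, Category.assoc]

variable {C : Type u₁} [Category.{v₁} C] [Abelian C] [MonoidalCategory C] [RigidCategory C]
  [MonoidalPreadditive C] [Simple (𝟙_ C)]
  {M : Type u₂} [Category.{v₂} M] [Abelian M] [MonoidalLeftAction C M]

theorem IsIndecomposableModuleCategory.exists_projective_hom_ne_zero
    [∀ X : C, (actionLeft M X).Additive] [∀ X : C, PreservesFiniteColimits (actionLeft M X)]
    [∀ m : M, PreservesFiniteColimits (actionRight C m)]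
    (h : IsIndecomposableModuleCategory C M) (hM : IsExactModuleCategory C M) {p : C}
    (hp : IsFiniteProgenerator p) (iHom : InternalHom C M) {m n : M} (hm : ¬ IsZero m)
    (hn : ¬ IsZero n) : ∃ (P : C) (f : P ⊙ₗ m ⟶ n), Projective P ∧ f ≠ 0 := by
  have := hp.enoughProjectives
  obtain ⟨X, f, hf⟩ := h.exists_hom_ne_zero hp hM iHom hm hn
  have : Epi (Projective.π X ⊵ₗ m) :=
    inferInstanceAs (Epi ((actionRight C m).map (Projective.π X)))
  exact ⟨Projective.over X, Projective.π X ⊵ₗ m ≫ f, inferInstance, fun h' =>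
    hf ((cancel_epi (Projective.π X ⊵ₗ m)).1 (h'.trans comp_zero.symm))⟩

variable {k : Type w} [Field k] [IsAlgClosed k] [Linear k C] [Linear k M]
  [IsFiniteModuleCategory k C M]

theorem IsIndecomposableModuleCategory.exists_evalAt_linearMap_ne_zero
    (hI : IsIndecomposableModuleCategory C M) (hM : IsExactModuleCategory C M) {p : C}
    (hp : IsFiniteProgenerator p) {q : M} (hq : IsFiniteProgenerator q)
    [∀ X Y : M, Module.Finite k (X ⟶ Y)] (iHom : InternalHom C M) (G : M ⥤ M) [G.Additive]
    [G.Linear k] [∀ X : C, (actionLeft M X).Additive] [∀ X : C, (actionLeft M X).Linear k]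
    {V : Submodule (End q ⊗[k] (End q)ᵐᵒᵖ) (EvalAt q G)} (hV : V ≠ ⊥) :
    ∃ (P : C) (g : EvalAt q (actionLeft M P) →ₗ[End q ⊗[k] (End q)ᵐᵒᵖ] EvalAt q G),
      Projective P ∧ g ≠ 0 ∧ ∀ x, g x ∈ V := by
  have (X : C) : PreservesFiniteColimits (actionLeft M X) :=
    IsFiniteModuleCategory.rightExact_actionLeft k X
  have (m : M) : PreservesFiniteColimits (actionRight C m) :=
    IsFiniteModuleCategory.rightExact_actionRight k m
  have := hq.projective
  have : Module.Finite k (End q) := inferInstanceAs (Module.Finite k (q ⟶ q))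
  obtain ⟨U⟩ := exists_matrixUnitsModJacobson k (End q)
  obtain ⟨i, v, hv, hv₀, hJv, hwv⟩ := U.exists_mem_smul_eq_self hV
  let e : q ⟶ q := U.w i 0
  have he : U.w i 0 ∉ Ring.jacobson (End q) := fun h => hv₀ (hwv.symm.trans (hJv _ h))
  -- The quotient of q by J and 1 - e, with e = w_i0: it is non-zero, J vanishes on it, and e
  -- becomes the identity.
  obtain ⟨N, c, _, hc, hc₀⟩ := hq.exists_quotient_of_submodule (k := k)
    ((Ring.jacobson (End q)).restrictScalars k ⊔ Submodule.span k {1 - U.w i 0})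
  have hcJ (r : q ⟶ q) (hr : r ∈ Ring.jacobson (End q)) : r ≫ c = 0 :=
    hc r (Submodule.mem_sup_left hr)
  have hce : e ≫ c = c := by
    have h := hc _ (Submodule.mem_sup_right (Submodule.mem_span_singleton_self _))
    have h' : (𝟙 q - e) ≫ c = 0 := h
    rw [Preadditive.sub_comp, Category.id_comp, sub_eq_zero] at h'
    exact h'.symm
  have hN : ¬ IsZero N := fun h => by
    obtain ⟨n, r, b, hr, h₁⟩ := hc₀ (h.eq_of_tgt _ _)
    exact U.one_ne_sum i he r b hr h₁
  let ι := Abelian.image.ι v.hom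
  have hW : ¬ IsZero (Abelian.image v.hom) := fun h => hv₀ (EvalAt.ext (by
    rw [← Abelian.image.fac v.hom, h.eq_of_src (Abelian.image.ι v.hom) 0, comp_zero,
      EvalAt.hom_zero]))
  obtain ⟨P, f, hP, hf₀⟩ := hI.exists_projective_hom_ne_zero hM hp iHom hN hW
  have hι (x : q ⟶ Abelian.image v.hom) : ∃ a : End q,
      (EvalAt.mk (x ≫ ι) : EvalAt q G) = ((1 : End q) ⊗ₜ[k] MulOpposite.op a) • v := by
    let a : q ⟶ q := Projective.factorThru x (Abelian.factorThruImage v.hom)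
    have ha : a ≫ Abelian.factorThruImage v.hom = x := Projective.factorThru_comp _ _
    refine ⟨a, EvalAt.ext ?_⟩
    rw [EvalAt.hom_tmul_smul]
    change x ≫ ι = a ≫ v.hom ≫ G.map (𝟙 q)
    rw [G.map_id, Category.comp_id, ← ha, Category.assoc, Abelian.image.fac]
  -- Passing through N makes composition with φ insensitive to J and to e on the source. Landing in
  -- the image of v makes every value a multiple (1 ⊗ a)v, which lies in V, is killed by J and is
  -- fixed by e.
  let φ : P ⊙ₗ q ⟶ G.obj q := P ⊴ₗ c ≫ f ≫ ι
  let f' : EvalAt q (actionLeft M P) →+ EvalAt q G :=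
    { toFun x := EvalAt.mk (x.hom ≫ φ)
      map_zero' := zero_comp
      map_add' x y := Preadditive.add_comp _ _ _ _ _ _ }
  have hf' (x) : ∃ a : End q, f' x = ((1 : End q) ⊗ₜ[k] MulOpposite.op a) • v := by
    obtain ⟨a, ha⟩ := hι (x.hom ≫ P ⊴ₗ c ≫ f)
    have key (y : q ⟶ P ⊙ₗ q) : y ≫ φ = (y ≫ P ⊴ₗ c ≫ f) ≫ ι := by
      simp only [φ, Category.assoc]
    exact ⟨a, (EvalAt.ext (key x.hom)).trans ha⟩
  have hsmul (r : q ⟶ q) (x : EvalAt q (actionLeft M P)) :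
      (f' (((show End q from r) ⊗ₜ[k] (1 : (End q)ᵐᵒᵖ)) • x)).hom =
        x.hom ≫ P ⊴ₗ (r ≫ c) ≫ f ≫ ι := by
    have key (y : q ⟶ P ⊙ₗ q) : (𝟙 q ≫ y ≫ P ⊴ₗ r) ≫ φ = y ≫ P ⊴ₗ (r ≫ c) ≫ f ≫ ι := by
      simp only [φ, Category.assoc, Category.id_comp, actionHomRight_comp]
    exact (congr_arg (· ≫ φ) (EvalAt.hom_tmul_smul _ _ x)).trans (key x.hom)
  have hcomm (r a : End q) : (r ⊗ₜ[k] (1 : (End q)ᵐᵒᵖ)) * ((1 : End q) ⊗ₜ[k] MulOpposite.op a) =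
      ((1 : End q) ⊗ₜ[k] MulOpposite.op a) * (r ⊗ₜ[k] (1 : (End q)ᵐᵒᵖ)) := by simp
  obtain ⟨g, hg, hgV⟩ := U.exists_linearMap_apply_smul_eq (A := (End q)ᵐᵒᵖ) f'
    (fun a x => EvalAt.ext (by
      have key (b : q ⟶ q) (y : q ⟶ P ⊙ₗ q) :
          (b ≫ y ≫ P ⊴ₗ 𝟙 q) ≫ φ = b ≫ (y ≫ φ) ≫ G.map (𝟙 q) := by
        simp only [Category.assoc, actionHomRight_id, G.map_id, Category.comp_id]
      rw [EvalAt.hom_tmul_smul]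
      exact (congr_arg (· ≫ φ) (EvalAt.hom_tmul_smul _ _ x)).trans (key a.unop x.hom)))
    (fun r hr x => EvalAt.ext (by
      have h₀ : P ⊴ₗ (0 : q ⟶ N) = 0 := (actionLeft M P).map_zero q N
      have key (y : q ⟶ P ⊙ₗ q) : y ≫ P ⊴ₗ ((show q ⟶ q from r) ≫ c) ≫ f ≫ ι = 0 := by
        rw [hcJ r hr, h₀, zero_comp, comp_zero]
      exact (hsmul r x).trans (key x.hom)))
    (fun r hr x => by
      obtain ⟨a, ha⟩ := hf' x
      rw [ha, ← mul_smul, hcomm, mul_smul, hJv r hr, smul_zero])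
    i
    (fun x => EvalAt.ext ((hsmul _ x).trans (by
      change x.hom ≫ P ⊴ₗ (e ≫ c) ≫ f ≫ ι = x.hom ≫ P ⊴ₗ c ≫ f ≫ ι
      rw [hce])))
    (fun x => by
      obtain ⟨a, ha⟩ := hf' x
      rw [ha, ← mul_smul, hcomm, mul_smul, hwv])
    (V := V)
    (fun x => by
      obtain ⟨a, ha⟩ := hf' x
      rw [ha]
      exact V.smul_mem _ hv)
  refine ⟨P, g, hP, fun hg₀ => hf₀ ?_, hgV⟩
  have : Epi (P ⊴ₗ c) := inferInstanceAs (Epi ((actionLeft M P).map c))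
  have hφ : φ = 0 := hq.hom_eq_zero _ fun x => by
    have h := congr_arg EvalAt.hom (hg (EvalAt.mk x))
    rw [hg₀] at h
    exact h.symm
  rw [← cancel_epi (P ⊴ₗ c), ← cancel_mono ι]
  simpa [φ] using hφ

/-- If α is non-zero, some non-zero t : ρ(P) ⟶ G has its bimodule map in the image of α and lifts to
s : ρ(P) ⟶ F. The transpose of s ≫ α is a composite with R(α), so R(α) = 0 would force t = 0. -/
theorem IsIndecomposableModuleCategory.faithful_of_adjunction
    (hI : IsIndecomposableModuleCategory C M) (hM : IsExactModuleCategory C M) {p : C}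
    (hp : IsFiniteProgenerator p) {q : M} (hq : IsFiniteProgenerator q)
    [∀ X Y : M, Module.Finite k (X ⟶ Y)] (iHom : InternalHom C M) {R : Rex k M ⥤ C}
    (adj : actionFunctor k C M ⊣ R) : R.Faithful := by
  have (X : C) : (actionLeft M X).Additive := IsFiniteModuleCategory.additive_actionLeft k X
  have (X : C) : (actionLeft M X).Linear k := IsFiniteModuleCategory.linear_actionLeft X
  have := hq.projective
  have := adj.right_adjoint_additive
  suffices ∀ {F G : Rex k M} (α : F ⟶ G), R.map α = 0 → α = 0 from
    ⟨fun {F G α β} h => sub_eq_zero.1 (this _ (by rw [R.map_sub, h, sub_self]))⟩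
  intro F G α hα
  have := F.property.1
  have := F.property.2.1
  have := F.property.2.2
  have := G.property.1
  have := G.property.2.1
  by_contra hα₀
  have hV : LinearMap.range (EvalAt.map (p := q) k α.hom) ≠ ⊥ := fun h => hα₀ (by
    ext1
    refine EvalAt.map_injective (k := k) hq (LinearMap.ext fun x => ?_)
    have h' : EvalAt.map k α.hom x = 0 := LinearMap.congr_fun (LinearMap.range_eq_bot.1 h) x
    rw [h']
    exact EvalAt.ext comp_zero.symm)
  obtain ⟨P, g, hP, hg₀, hg⟩ := hI.exists_evalAt_linearMap_ne_zero hM hp hq iHom G.obj hV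
  have : PreservesFiniteColimits (actionLeft M P) :=
    IsFiniteModuleCategory.rightExact_actionLeft k P
  obtain ⟨t, ht⟩ := EvalAt.map_surjective hq g
  obtain ⟨s, hs⟩ := hM.exists_lift hq P α (ObjectProperty.homMk t) fun v => by
    obtain ⟨w, hw⟩ := hg (EvalAt.mk v)
    refine ⟨w.hom, (congr_arg EvalAt.hom hw).trans ?_⟩
    rw [← ht]
    rfl
  have h₀ : s ≫ α = 0 := by
    apply (adj.homEquiv _ _).injective
    rw [adj.homEquiv_naturality_right, hα, comp_zero, Adjunction.homEquiv_unit, Functor.map_zero,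
      comp_zero]
  refine hg₀ (LinearMap.ext fun x => EvalAt.ext ?_)
  rw [← ht]
  have h : t = 0 := congr_arg (fun t => t.hom) (hs.symm.trans h₀)
  rw [h]
  exact comp_zero

end Faithful

end

theorem mainTheorem1 (k : Type w) [Field k] [IsAlgClosed k]
    (C : Type u₁) [Category.{v₁} C] [Preadditive C] [Linear k C] [MonoidalCategory C]
    [RigidCategory C] [IsFiniteTensorCategory k C]
    (M : Type u₂) [Category.{v₂} M] [Preadditive M] [Linear k M] [MonoidalLeftAction C M]
    [IsFiniteModuleCategory k C M] :
    Nonempty (InternalHom C M) ∧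
    ∀ iHom : InternalHom C M,
      ∃ h : ∀ F : Rex k M, HasEnd (iHom.twist.obj F),
        Nonempty (actionFunctor k C M ⊣ iHom.endFunctor h) ∧
        (IsExactModuleCategory C M →
          PreservesFiniteLimits (iHom.endFunctor h) ∧
          PreservesFiniteColimits (iHom.endFunctor h)) ∧
        (IsExactModuleCategory C M → IsIndecomposableModuleCategory C M →
          (iHom.endFunctor h).Faithful) := by
  have hC : IsFiniteAbelianCategory k C := IsFiniteTensorCategory.isFiniteAbelian
  have hM : IsFiniteAbelianCategory k M := IsFiniteModuleCategory.isFiniteAbelian C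
  obtain ⟨p, hp⟩ := hC.exists_isFiniteProgenerator k C
  obtain ⟨q, hq⟩ := hM.exists_isFiniteProgenerator k M
  have := hC.finite_hom k C
  have := hM.finite_hom k M
  have := IsFiniteTensorCategory.monoidalPreadditive k C
  have : Simple (𝟙_ C) := IsFiniteTensorCategory.simple_unit k
  obtain ⟨_, rfl⟩ := hC.exists_abelian k C
  obtain ⟨_, rfl⟩ := hM.exists_abelian k M
  refine ⟨exists_internalHom (k := k) hp, fun iHom =>
    ⟨fun F => hp.hasEnd_twist (k := k) hq iHom F, ⟨iHom.actionFunctorAdjEndFunctor _⟩,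
      fun hE => ⟨?_, ?_⟩, fun hE hI => ?_⟩⟩
  · have := (iHom.actionFunctorAdjEndFunctor fun F =>
      hp.hasEnd_twist (k := k) hq iHom F).rightAdjoint_preservesLimits
    infer_instance
  · exact hE.preservesFiniteColimits_of_adjunction (k := k) hp hq
      (iHom.actionFunctorAdjEndFunctor _)
  · exact hI.faithful_of_adjunction (k := k) hE hp hq iHom (iHom.actionFunctorAdjEndFunctor _)
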